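/- Let $n\ge 1$. A density operator is a positive semidefinite matrix $\rho\in\mathbb{C}^{n\times n}$ with $\mathrm{Tr}\,\rho=1$. A purified query oracle for $\rho$ is a unitary $U_\rho$ on $A\otimes B$, where $A=\mathbb{C}^{k}$ (for some $k\ge1$) and $B=\mathbb{C}^n$, such that the state $|\psi_\rho\rangle=U_\rho|0\rangle_A|0\rangle_B$ satisfies $\mathrm{Tr}_A\,|\psi_\rho\rangle\langle\psi_\rho|=\rho$. A quantum query algorithm with access to two such oracles $U_\rho,U_\sigma$ starts in a fixed computational basis state of a finite-dimensional memory that consists of one register for each oracle and a work space, applies a fixed finite sequence of unitaries that do not depend on the oracles, interleaved with queries, i.e. applications of $U_\rho,U_\rho^\dagger$ or $U_\sigma,U_\sigma^\dagger$ to the corresponding register, and finally measures in the computational basis and outputs a bit that is a function of the outcome. Let $\|X\|_2=(\sum_i s_i^2)^{1/2}$, with $s_i$ the singular values of $X$, be the Schatten $2$-norm. Theorem. There is a universal constant $C>0$ such that for all $n\ge1$, all $\epsilon,\nu\in(0,1)$ and all dimensions $k,l\ge 1$ of the purifying registers there is a quantum query algorithm, depending only on $n,k,l,\epsilon,\nu$,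 that makes at most $$C\cdot\min\left(\frac{\sqrt n}{\epsilon},\frac1{\epsilon^2}\right)\cdot\frac1\nu$$ queries to $U_\rho,U_\rho^\dagger,U_\sigma,U_\sigma^\dagger$ in total and that, for all density operators $\rho,\sigma\in\mathbb{C}^{n\times n}$ and all purified query oracles $U_\rho$ (on $\mathbb{C}^k\otimes\mathbb{C}^n$) for $\rho$ and $U_\sigma$ (on $\mathbb{C}^l\otimes\mathbb{C}^n$) for $\sigma$, decides with success probability at least $2/3$ whether $\|\rho-\sigma\|_2\ge\epsilon$ or $\|\rho-\sigma\|_2\le(1-\nu)\epsilon$: in the first case it outputs $1$ with probability at least $2/3$, and in the second case it outputs $0$ with probability at least $2/3$. -/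

import Mathlib

open scoped Matrix Kronecker ComplexOrder

noncomputable section

/-- The Schatten `α`-norm `(∑ᵢ sᵢ ^ α) ^ (1 / α)` of a complex square matrix, where the `sᵢ` are its
singular values, i.e. the square roots of the eigenvalues of `Aᴴ * A`. -/
def schattenNorm {n : ℕ} (α : ℝ) (A : Matrix (Fin n) (Fin n) ℂ) : ℝ :=
  (∑ i, Real.sqrt ((Matrix.isHermitian_conjTranspose_mul_self A).eigenvalues i) ^ α) ^ (1 / α)

/-- A density operator: a positive semidefinite matrix of trace one. -/
def IsDensityOperator {n : ℕ} (ρ : Matrix (Fin n) (Fin n) ℂ) : Prop :=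
  ρ.PosSemidef ∧ ρ.trace = 1

/-- The partial trace over the first tensor factor `A = ℂ^k` of an operator on `A ⊗ B`, `B = ℂ^n`. -/
def partialTraceA {k n : ℕ} (X : Matrix (Fin k × Fin n) (Fin k × Fin n) ℂ) :
    Matrix (Fin n) (Fin n) ℂ :=
  Matrix.of fun b b' => ∑ a, X (a, b) (a, b')

/-- The unitary `U` on `ℂ^k ⊗ ℂ^n` is a purified query oracle for `ρ`: with `|ψ⟩ = U |0⟩_A |0⟩_B`
one has `Tr_A |ψ⟩⟨ψ| = ρ`. -/
def IsPurifiedOracle {k n : ℕ} [NeZero k] [NeZero n]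
    (U : Matrix.unitaryGroup (Fin k × Fin n) ℂ) (ρ : Matrix (Fin n) (Fin n) ℂ) : Prop :=
  let ψ : Fin k × Fin n → ℂ :=
    (U : Matrix (Fin k × Fin n) (Fin k × Fin n) ℂ) *ᵥ Pi.single ((0, 0) : Fin k × Fin n) 1
  partialTraceA (Matrix.vecMulVec ψ (star ψ)) = ρ

/-- The four kinds of queries: `U_ρ`, `U_ρ†`, `U_σ`, `U_σ†`. -/
inductive OracleCall : Type
  | rho
  | rhoInv
  | sigma
  | sigmaInv

/-- Labels of the computational basis of the algorithm's memory
`(ℂ^k ⊗ ℂ^n) ⊗ (ℂ^l ⊗ ℂ^n) ⊗ ℂ^W`: a register for queries to `U_ρ` and `U_ρ†`, a register for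
queries to `U_σ` and `U_σ†`, and a work space. -/
abbrev Memory (k l n : ℕ) (W : Type) : Type :=
  (Fin k × Fin n) × ((Fin l × Fin n) × W)

/-- One step of a quantum query algorithm: an arbitrary unitary gate on the whole memory (which
does not depend on the oracles), or one query. -/
inductive QueryStep (k l n : ℕ) (W : Type) [Fintype W] [DecidableEq W] : Type
  | gate (V : Matrix.unitaryGroup (Memory k l n W) ℂ)
  | query (o : OracleCall)

namespace QueryStep

variable {k l n : ℕ} {W : Type} [Fintype W] [DecidableEq W]

def isQuery : QueryStep k l n W → Bool
  | gate _ => false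
  | query _ => true

/-- The operator that a step applies to the memory, given the two oracles. -/
def toMatrix (Uρ : Matrix.unitaryGroup (Fin k × Fin n) ℂ)
    (Uσ : Matrix.unitaryGroup (Fin l × Fin n) ℂ) :
    QueryStep k l n W → Matrix (Memory k l n W) (Memory k l n W) ℂ
  | gate V => V.1
  | query .rho => Uρ.1 ⊗ₖ (1 : Matrix ((Fin l × Fin n) × W) ((Fin l × Fin n) × W) ℂ)
  | query .rhoInv => Uρ.1ᴴ ⊗ₖ (1 : Matrix ((Fin l × Fin n) × W) ((Fin l × Fin n) × W) ℂ)
  | query .sigma =>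
      (1 : Matrix (Fin k × Fin n) (Fin k × Fin n) ℂ) ⊗ₖ (Uσ.1 ⊗ₖ (1 : Matrix W W ℂ))
  | query .sigmaInv =>
      (1 : Matrix (Fin k × Fin n) (Fin k × Fin n) ℂ) ⊗ₖ (Uσ.1ᴴ ⊗ₖ (1 : Matrix W W ℂ))

end QueryStep

/-- A quantum query algorithm with a one-bit output and access to two unitary oracles, on
`ℂ^k ⊗ ℂ^n` and on `ℂ^l ⊗ ℂ^n`, and their inverses: it starts in a computational basis state,
performs a fixed finite sequence of steps, measures the memory in the computational basis, and
computes its output from the measured basis label. -/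
structure QueryAlgorithm (k l n : ℕ) : Type 1 where
  W : Type
  fintypeW : Fintype W
  decidableEqW : DecidableEq W
  start : Memory k l n W
  steps : List (QueryStep k l n W)
  output : Memory k l n W → Bool

attribute [instance] QueryAlgorithm.fintypeW QueryAlgorithm.decidableEqW

namespace QueryAlgorithm

variable {k l n : ℕ}

/-- The total number of queries made to `U_ρ`, `U_ρ†`, `U_σ`, `U_σ†`. -/
def queryCount (𝒜 : QueryAlgorithm k l n) : ℕ :=
  𝒜.steps.countP QueryStep.isQuery

/-- The state of the memory after all steps (the head of the list of steps is applied first). -/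
def finalState (𝒜 : QueryAlgorithm k l n) (Uρ : Matrix.unitaryGroup (Fin k × Fin n) ℂ)
    (Uσ : Matrix.unitaryGroup (Fin l × Fin n) ℂ) : Memory k l n 𝒜.W → ℂ :=
  𝒜.steps.foldl (fun v s => s.toMatrix Uρ Uσ *ᵥ v) (Pi.single 𝒜.start 1)

/-- The probability that the algorithm outputs the bit `b` (Born rule). -/
def outputProb (𝒜 : QueryAlgorithm k l n) (Uρ : Matrix.unitaryGroup (Fin k × Fin n) ℂ)
    (Uσ : Matrix.unitaryGroup (Fin l × Fin n) ℂ) (b : Bool) : ℝ :=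
  ∑ x with 𝒜.output x = b, ‖𝒜.finalState Uρ Uσ x‖ ^ 2

end QueryAlgorithm

end

open scoped Matrix Kronecker ComplexOrder

noncomputable section

/-! Both bounds reduce to one task: a circuit `Q` with `q` queries sends a fixed unit vector `η` to
`ψ`, and one must decide whether `a = ‖P ψ‖` is at least `α` or at most `α - δ` for a known
projection `P`. `exists_algorithm_of_circuit` does this with `O(q / δ)` queries.

Let `A = 2P - 1` and `B = 2|ψ⟩⟨ψ| - 1`, the latter being a conjugate by `Q` of a fixed reflection.
The alternating orbit `y` of `ψ` satisfies `(A + B) y (t+1) = y (t+2) + y t`, while `(A + B)²`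
commutes with `A` and `B` and equals `4a²` on `ψ`, hence on the whole orbit. So `C = (A + B)/2`
(with a parity flag flipped) scales the orbit by `a` and acts as half the adjacency operator of a
path on its index. If a counter holds `∑ f t |t⟩ y (t+1)` with a slowly varying window `f` that
vanishes at both ends, the path matrix on the counter nearly agrees with `C`. Measuring the counter
in the eigenbasis of the path matrix therefore gives `λ` with `|λ|` close to `a` in mean square
(`exists_window_reflections`), and Chebyshev's inequality finishes. This replaces phase estimation
and needs no explicit eigenvalues.

Two circuits supply the amplitude. Block-encoding `ρ` or `σ`, according to a coin, on a maximally
entangled state and projecting on the unfair coin gives `a = ‖ρ - σ‖₂ / (2√n)`, so `δ` is of order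
`εν/√n`. A swap test with signed coins gives `a² = (1 + ‖ρ - σ‖₂²/4)/2`, so `δ` is of order `ε²ν`.
The algorithm uses whichever bound is smaller. -/

/-- The Euclidean norm of a complex vector. -/
def l2 {ι : Type*} [Fintype ι] (v : ι → ℂ) : ℝ := ‖(WithLp.toLp 2 v : EuclideanSpace ℂ ι)‖

/-! ### Euclidean norms and Parseval's identity -/

section l2

variable {ι κ : Type*} [Fintype ι] [Fintype κ]

theorem l2_sq (v : ι → ℂ) : l2 v ^ 2 = ∑ i, ‖v i‖ ^ 2 := by
  simp [l2, EuclideanSpace.norm_sq_eq]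

theorem l2_nonneg (v : ι → ℂ) : 0 ≤ l2 v := norm_nonneg _

theorem l2_add_le (v w : ι → ℂ) : l2 (v + w) ≤ l2 v + l2 w := by
  simpa [l2] using norm_add_le (WithLp.toLp 2 v : EuclideanSpace ℂ ι) (WithLp.toLp 2 w)

theorem abs_l2_sub_le (v w : ι → ℂ) : |l2 v - l2 w| ≤ l2 (v - w) := by
  simpa [l2] using abs_norm_sub_norm_le (WithLp.toLp 2 v : EuclideanSpace ℂ ι) (WithLp.toLp 2 w)

theorem l2_smul (c : ℂ) (v : ι → ℂ) : l2 (c • v) = ‖c‖ * l2 v := by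
  simpa [l2] using norm_smul c (WithLp.toLp 2 v : EuclideanSpace ℂ ι)

theorem l2_sq_eq_dotProduct (v : ι → ℂ) : ((l2 v ^ 2 : ℝ) : ℂ) = star v ⬝ᵥ v := by
  rw [l2_sq, dotProduct]
  push_cast
  refine Finset.sum_congr rfl fun i _ => ?_
  rw [Pi.star_apply, RCLike.star_def, RCLike.conj_mul]
  rfl

theorem star_mulVec_dotProduct_mulVec (A : Matrix κ ι ℂ) (v : ι → ℂ) :
    star (A *ᵥ v) ⬝ᵥ (A *ᵥ v) = star v ⬝ᵥ ((Aᴴ * A) *ᵥ v) := by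
  rw [Matrix.star_mulVec, ← Matrix.dotProduct_mulVec, Matrix.mulVec_mulVec]

theorem l2_mulVec_of_gram {A : Matrix κ ι ℂ} {v : ι → ℂ} {a : ℝ} (ha : 0 ≤ a)
    (h : (Aᴴ * A) *ᵥ v = ((a ^ 2 : ℝ) : ℂ) • v) : l2 (A *ᵥ v) = a * l2 v := by
  have : ((l2 (A *ᵥ v) ^ 2 : ℝ) : ℂ) = (((a * l2 v) ^ 2 : ℝ) : ℂ) := by
    rw [l2_sq_eq_dotProduct, star_mulVec_dotProduct_mulVec, h, dotProduct_smul,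
      ← l2_sq_eq_dotProduct, smul_eq_mul, ← Complex.ofReal_mul, mul_pow]
  exact (pow_left_inj₀ (l2_nonneg _) (mul_nonneg ha (l2_nonneg _)) two_ne_zero).1
    (Complex.ofReal_injective this)

theorem l2_mulVec_of_conjTranspose_mul_self [DecidableEq ι] {U : Matrix κ ι ℂ} (hU : Uᴴ * U = 1)
    (v : ι → ℂ) : l2 (U *ᵥ v) = l2 v := by
  simpa using l2_mulVec_of_gram (A := U) (v := v) (a := 1) zero_le_one (by simp [hU])

/-- Parseval's identity for a unitary matrix applied to a family of vectors. -/
theorem sum_l2_sq_unitary_combination [DecidableEq ι] {U : Matrix ι ι ℂ} (hU : Uᴴ * U = 1)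
    (Z : ι → κ → ℂ) :
    ∑ j, l2 (∑ t, U j t • Z t) ^ 2 = ∑ t, l2 (Z t) ^ 2 := by
  simp only [l2_sq]
  rw [Finset.sum_comm, Finset.sum_comm (s := Finset.univ) (t := Finset.univ)
    (f := fun t i => ‖Z t i‖ ^ 2)]
  refine Finset.sum_congr rfl fun i _ => ?_
  have := l2_mulVec_of_conjTranspose_mul_self hU (fun t => Z t i)
  have h2 := congrArg (· ^ 2) this
  simp only [l2_sq] at h2
  rw [← h2]
  refine Finset.sum_congr rfl fun j _ => ?_
  simp [Matrix.mulVec, dotProduct, Finset.sum_apply]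

end l2

/-! ### Spectral concentration for windows on a path -/

section Concentration

variable {ι κ : Type*} [Fintype ι] [DecidableEq ι] [Fintype κ]

/-- If a family `X` of vectors is such that the action of the Hermitian matrix `M` on its index is
close to the action of `C` on its members, and `C` scales the relevant norms by `a`, then the
absolute values of the eigenvalues of `M` in the spectral measure of `X` concentrate around `a`. -/
theorem sum_sq_abs_eigenvalue_sub_le {M : Matrix ι ι ℂ} (hM : M.IsHermitian) {C : Matrix κ κ ℂ}
    {X : ι → κ → ℂ} {a : ℝ} (ha : 0 ≤ a)
    (hC : ∀ t, (Cᴴ * C) *ᵥ X t = ((a ^ 2 : ℝ) : ℂ) • X t) :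
    ∑ j, (|hM.eigenvalues j| - a) ^ 2 *
        l2 (∑ t, (hM.eigenvectorUnitary : Matrix ι ι ℂ)ᴴ j t • X t) ^ 2
      ≤ ∑ t, l2 ((∑ s, M t s • X s) - C *ᵥ X t) ^ 2 := by
  set V : Matrix ι ι ℂ := (hM.eigenvectorUnitary : Matrix ι ι ℂ) with hV
  have hVV : V * Vᴴ = 1 := Unitary.mul_star_self_of_mem hM.eigenvectorUnitary.2
  have hVV' : Vᴴ * V = 1 := Unitary.star_mul_self_of_mem hM.eigenvectorUnitary.2
  have hdiag : Vᴴ * M = Matrix.diagonal (fun j => (hM.eigenvalues j : ℂ)) * Vᴴ := by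
    have h := hM.spectral_theorem
    rw [Unitary.conjStarAlgAut_apply] at h
    conv_lhs => rw [h]
    change Vᴴ * (V * _ * Vᴴ) = _
    rw [← Matrix.mul_assoc, ← Matrix.mul_assoc, hVV', Matrix.one_mul]
    rfl
  -- Rotating the family of errors into the eigenbasis of `M` preserves its total squared norm, so
  -- the two sums can be compared eigenvector by eigenvector.
  rw [← sum_l2_sq_unitary_combination (U := Vᴴ) (by simpa using hVV)]
  refine Finset.sum_le_sum fun j _ => ?_
  set x : κ → ℂ := ∑ t, Vᴴ j t • X t with hx
  have hCx : (Cᴴ * C) *ᵥ x = ((a ^ 2 : ℝ) : ℂ) • x := by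
    simp only [hx, Matrix.mulVec_sum, Matrix.mulVec_smul, hC, Finset.smul_sum]
    exact Finset.sum_congr rfl fun t _ => smul_comm _ _ _
  have hx' : ∑ t, Vᴴ j t • ((∑ s, M t s • X s) - C *ᵥ X t)
      = (hM.eigenvalues j : ℂ) • x - C *ᵥ x := by
    simp only [smul_sub, Finset.sum_sub_distrib]
    congr 1
    · simp only [Finset.smul_sum, smul_smul]
      rw [Finset.sum_comm]
      simp only [← Finset.sum_smul]
      have : ∀ s, ∑ t, Vᴴ j t * M t s = (hM.eigenvalues j : ℂ) * Vᴴ j s := fun s => by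
        rw [← Matrix.mul_apply, hdiag, Matrix.diagonal_mul]
      simp only [this, hx, Finset.smul_sum, smul_smul]
    · simp only [hx, Matrix.mulVec_sum, Matrix.mulVec_smul]
  rw [hx', ← mul_pow]
  -- Only `‖C x‖ = a ‖x‖` is known, so the reverse triangle inequality controls `|λ|` and loses the
  -- sign of `λ`.
  have h1 := abs_l2_sub_le ((hM.eigenvalues j : ℂ) • x) (C *ᵥ x)
  rw [l2_smul, l2_mulVec_of_gram ha hCx, ← sub_mul, Complex.norm_real, Real.norm_eq_abs,
    abs_mul, abs_of_nonneg (l2_nonneg x)] at h1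
  rw [← sq_abs, abs_mul, abs_of_nonneg (l2_nonneg x)]
  exact pow_le_pow_left₀ (by positivity [l2_nonneg x]) h1 2

/-- One half of the adjacency matrix of the path with `N` vertices. -/
def pathMatrix (N : ℕ) : Matrix (Fin N) (Fin N) ℂ :=
  Matrix.of fun i j => (if (j : ℕ) = i + 1 then 1 / 2 else 0) + (if (i : ℕ) = j + 1 then 1 / 2 else 0)

theorem pathMatrix_isHermitian (N : ℕ) : (pathMatrix N).IsHermitian := by
  ext i j
  simp only [pathMatrix, Matrix.conjTranspose_apply, Matrix.of_apply, star_add, apply_ite star]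
  simp [add_comm]

/-- Vertex `t` carries `g (t + 1)`, so the neighbours missing at the two ends are `g 0` and `g (N +
1)`; their vanishing makes the formula uniform in `t`. -/
theorem sum_pathMatrix_smul {E : Type*} [AddCommGroup E] [Module ℂ E] {N : ℕ} (g : ℕ → E)
    (h0 : g 0 = 0) (hN : g (N + 1) = 0) (t : Fin N) :
    ∑ s : Fin N, pathMatrix N t s • g (s + 1) = (1 / 2 : ℂ) • (g (t + 2) + g t) := by
  simp only [pathMatrix, Matrix.of_apply, add_smul, Finset.sum_add_distrib, ite_smul, zero_smul,
    smul_add]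
  congr 1
  · rw [Fin.sum_univ_eq_sum_range (fun s => if s = (t : ℕ) + 1 then (1 / 2 : ℂ) • g (s + 1) else 0),
      Finset.sum_ite_eq']
    split_ifs with h
    · rfl
    · have : (t : ℕ) + 1 = N := by have := t.2; simp at h; omega
      rw [show (t : ℕ) + 2 = N + 1 by omega, hN, smul_zero]
  · rcases Nat.eq_zero_or_pos (t : ℕ) with h | h
    · rw [h, h0, smul_zero]
      exact Finset.sum_eq_zero fun s _ => if_neg (by omega)
    · rw [Fin.sum_univ_eq_sum_range
        (fun s => if (t : ℕ) = s + 1 then (1 / 2 : ℂ) • g (s + 1) else 0),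
        Finset.sum_eq_single ((t : ℕ) - 1)]
      · rw [if_pos (by omega), Nat.sub_add_cancel h]
      · intro b _ hb
        exact if_neg (by omega)
      · intro hb
        have := t.2
        simp at hb
        omega

/-- The triangular window with peak at `m` and support strictly between `0` and `2 * m`. -/
def triangle (m : ℕ) (i : ℕ) : ℝ := min (i : ℝ) (2 * m - i)

theorem abs_triangle_sub_le (m i : ℕ) : |triangle m (i + 1) - triangle m i| ≤ 1 := by
  unfold triangle
  push_cast
  rw [abs_le]
  rcases min_cases ((i : ℝ) + 1) (2 * m - (i + 1)) with h | h <;>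
    rcases min_cases (i : ℝ) (2 * m - i) with h' | h' <;> constructor <;> linarith

/-- Pairing `i` with `m + i` gives `i² + (m - i)² ≥ m²/2` for each of the `m` pairs. -/
theorem cube_le_sum_sq_triangle (m : ℕ) :
    (m : ℝ) ^ 3 / 2 ≤ ∑ i ∈ Finset.range (2 * m), triangle m i ^ 2 := by
  rw [two_mul, Finset.sum_range_add, ← Finset.sum_add_distrib]
  have : ∀ i ∈ Finset.range m, (m : ℝ) ^ 2 / 2 ≤ triangle m i ^ 2 + triangle m (m + i) ^ 2 := by
    intro i hi
    have hi' : (i : ℝ) ≤ m := by exact_mod_cast (Finset.mem_range.1 hi).le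
    have h1 : triangle m i = i := min_eq_left (by linarith)
    have h2 : triangle m (m + i) = m - i := by
      unfold triangle
      push_cast
      rw [min_eq_right (by linarith [(Nat.cast_nonneg i : (0 : ℝ) ≤ i)])]
      ring
    rw [h1, h2]
    nlinarith [sq_nonneg ((m : ℝ) - 2 * i)]
  refine le_trans (le_of_eq ?_) (Finset.sum_le_sum this)
  simp
  ring

/-- A normalized window on a path with `2 * m + 1` vertices for which every walk whose consecutive
members are related by `C` has a sharp estimate of the scaling factor of `C`. -/
theorem exists_window (m : ℕ) :
    ∃ f : Fin (2 * m + 1) → ℝ, ∑ t, f t ^ 2 = 1 ∧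
      ∀ {κ : Type} [Fintype κ] (C : Matrix κ κ ℂ) (y : ℕ → κ → ℂ) (a : ℝ), 0 ≤ a →
        (∀ t, (Cᴴ * C) *ᵥ y t = ((a ^ 2 : ℝ) : ℂ) • y t) →
        (∀ t, C *ᵥ y (t + 1) = (1 / 2 : ℂ) • (y (t + 2) + y t)) →
        (∀ t, l2 (y t) = 1) →
        ∑ j, (|(pathMatrix_isHermitian (2 * m + 1)).eigenvalues j| - a) ^ 2 *
          l2 (∑ t : Fin (2 * m + 1), ((pathMatrix_isHermitian (2 * m + 1)).eigenvectorUnitary :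
            Matrix _ _ ℂ)ᴴ j t • (f t : ℂ) • y (t + 1)) ^ 2 ≤ 4 / (m + 1) ^ 2 := by
  set S : ℝ := ∑ i ∈ Finset.range (2 * (m + 1)), triangle (m + 1) i ^ 2 with hS
  have hm : (0 : ℝ) < m + 1 := by positivity
  have hS1 : ((m : ℝ) + 1) ^ 3 / 2 ≤ S := by simpa using cube_le_sum_sq_triangle (m + 1)
  have hS0 : 0 < S := lt_of_lt_of_le (by positivity) hS1
  -- The peak is at `m + 1` so that the zeros `0` and `2m + 2` lie just outside the vertices, which
  -- occupy `1, …, 2m + 1`.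
  set F : ℕ → ℝ := fun i => triangle (m + 1) i / √S with hF
  have hF0 : F 0 = 0 := by simp [hF, triangle]; left; positivity
  have hFN : F (2 * m + 1 + 1) = 0 := by
    simp only [hF, triangle]
    push_cast
    rw [min_eq_right (by linarith)]
    simp; left; ring
  have hFd : ∀ i, (F (i + 1) - F i) ^ 2 ≤ 1 / S := by
    intro i
    simp only [hF]
    rw [← sub_div, div_pow, Real.sq_sqrt hS0.le]
    gcongr
    rw [← sq_abs]
    exact pow_le_one₀ (abs_nonneg _) (abs_triangle_sub_le _ _)
  refine ⟨fun t => F (t + 1), ?_, ?_⟩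
  · rw [Fin.sum_univ_eq_sum_range (fun t => F (t + 1) ^ 2)]
    have h1 : ∑ i ∈ Finset.range (2 * m + 1 + 1), F i ^ 2 = 1 := by
      simp only [hF, div_pow, Real.sq_sqrt hS0.le]
      rw [← Finset.sum_div, div_eq_one_iff_eq hS0.ne', hS]
      rfl
    rw [Finset.sum_range_succ', hF0] at h1
    simpa using h1
  intro κ _ C y a ha hC2 hC hy
  refine (sum_sq_abs_eigenvalue_sub_le (pathMatrix_isHermitian (2 * m + 1)) (C := C) ha ?_).trans ?_
  · intro t
    rw [Matrix.mulVec_smul, hC2, smul_comm]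
  have hZ : ∀ t : Fin (2 * m + 1),
      l2 ((∑ s, pathMatrix (2 * m + 1) t s • ((F (s + 1) : ℝ) : ℂ) • y (s + 1))
        - C *ᵥ (((F (t + 1) : ℝ) : ℂ) • y (t + 1))) ^ 2 ≤ 1 / S := by
    intro t
    rw [sum_pathMatrix_smul (fun s => ((F s : ℝ) : ℂ) • y s) (by simp [hF0]) (by simp [hFN]),
      Matrix.mulVec_smul, hC]
    -- A discrete product rule: the walk relation cancels everything except increments of the
    -- window, each at most `1/√S` in absolute value.
    have : (1 / 2 : ℂ) • (((F (t + 2) : ℝ) : ℂ) • y (t + 2) + ((F t : ℝ) : ℂ) • y t)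
        - ((F (t + 1) : ℝ) : ℂ) • (1 / 2 : ℂ) • (y (t + 2) + y t)
        = ((1 / 2 * (F (t + 2) - F (t + 1)) : ℝ) : ℂ) • y (t + 2)
          + ((- (1 / 2 * (F (t + 1) - F t)) : ℝ) : ℂ) • y t := by
      push_cast
      module
    rw [this]
    have h1 := l2_add_le (((1 / 2 * (F (t + 2) - F (t + 1)) : ℝ) : ℂ) • y (t + 2))
      (((- (1 / 2 * (F (t + 1) - F t)) : ℝ) : ℂ) • y t)
    rw [l2_smul, l2_smul, hy, hy, Complex.norm_real, Complex.norm_real, Real.norm_eq_abs,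
      Real.norm_eq_abs, abs_neg, abs_mul, abs_mul, abs_of_pos (by norm_num : (0 : ℝ) < 1 / 2)] at h1
    have h2 := hFd t
    have h3 := hFd (t + 1)
    have h4 := pow_le_pow_left₀ (l2_nonneg _) h1 2
    refine h4.trans ?_
    rw [← sq_abs] at h2 h3
    nlinarith [sq_nonneg (|F (t + 1 + 1) - F (t + 1)| - |F (t + 1) - F t|)]
  refine (Finset.sum_le_sum fun t _ => hZ t).trans ?_
  simp only [Finset.sum_const, Finset.card_univ, Fintype.card_fin, nsmul_eq_mul]
  push_cast
  -- There are `2m + 1` errors of size at most `1/S`, and `S ≥ (m + 1)³/2`.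
  rw [mul_one_div, div_le_div_iff₀ hS0 (by positivity)]
  nlinarith

end Concentration

/-! ### The alternating walk of two reflections -/

section Walk

variable {ι : Type*}

theorem reflection_conjTranspose [DecidableEq ι] {P : Matrix ι ι ℂ} (hP : Pᴴ = P) :
    ((2 : ℂ) • P - 1)ᴴ = (2 : ℂ) • P - 1 := by
  simp [Matrix.conjTranspose_sub, Matrix.conjTranspose_smul, hP]

theorem rankOne_conjTranspose (η : ι → ℂ) :
    (Matrix.vecMulVec η (star η))ᴴ = Matrix.vecMulVec η (star η) := by
  simp [Matrix.conjTranspose_vecMulVec]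

/-- The matrix that flips the flag and acts by `Y` on the second factor. -/
def flagFlip (Y : Matrix ι ι ℂ) : Matrix (Bool × ι) (Bool × ι) ℂ :=
  Matrix.of fun p q => if p.1 = q.1 then 0 else Y p.2 q.2

theorem flagFlip_conjTranspose (Y : Matrix ι ι ℂ) : (flagFlip Y)ᴴ = flagFlip Yᴴ := by
  ext ⟨b, i⟩ ⟨b', i'⟩
  cases b <;> cases b' <;> simp [flagFlip, Matrix.conjTranspose_apply]

variable [Fintype ι]

theorem star_dotProduct_self_eq_one {η : ι → ℂ} (hη : l2 η = 1) : star η ⬝ᵥ η = 1 := by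
  rw [← l2_sq_eq_dotProduct, hη]; simp

theorem flagFlip_mulVec (Y : Matrix ι ι ℂ) (x : Bool × ι → ℂ) (b : Bool) (i : ι) :
    (flagFlip Y *ᵥ x) (b, i) = (Y *ᵥ fun i' => x (!b, i')) i := by
  simp only [Matrix.mulVec, dotProduct, Fintype.sum_prod_type, flagFlip, Matrix.of_apply]
  cases b <;> simp

theorem rankOne_mul_self {η : ι → ℂ} (hη : l2 η = 1) :
    Matrix.vecMulVec η (star η) * Matrix.vecMulVec η (star η) = Matrix.vecMulVec η (star η) := by
  rw [Matrix.vecMulVec_mul_vecMulVec, star_dotProduct_self_eq_one hη, one_smul]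

/-- The orbit of `ψ` under the alternating application of `A` and `B`; the term with index `1` is
`ψ`, and so is its predecessor. -/
def alternatingOrbit (A B : Matrix ι ι ℂ) (ψ : ι → ℂ) : ℕ → ι → ℂ
  | 0 => ψ
  | 1 => ψ
  | t + 2 => (if t.bodd then B else A) *ᵥ alternatingOrbit A B ψ (t + 1)

/-- The orbit with its parity stored in a flag. -/
def flaggedOrbit (A B : Matrix ι ι ℂ) (ψ : ι → ℂ) (t : ℕ) : Bool × ι → ℂ :=
  fun p => if p.1 = t.bodd then alternatingOrbit A B ψ t p.2 else 0

variable {A B : Matrix ι ι ℂ} {ψ : ι → ℂ}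

/-- Two flips restore the flag, so the square acts as `Y * Y` on each flag value separately. -/
theorem sq_flagFlip_mulVec_flaggedOrbit {Y : Matrix ι ι ℂ} {c : ℂ} {t : ℕ}
    (h : (Y * Y) *ᵥ alternatingOrbit A B ψ t = c • alternatingOrbit A B ψ t) :
    (flagFlip Y * flagFlip Y) *ᵥ flaggedOrbit A B ψ t = c • flaggedOrbit A B ψ t := by
  ext ⟨b, i⟩
  rw [← Matrix.mulVec_mulVec, flagFlip_mulVec]
  simp only [flagFlip_mulVec, Bool.not_not]
  have h1 : (fun i' => flaggedOrbit A B ψ t (b, i'))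
      = if b = t.bodd then alternatingOrbit A B ψ t else 0 := by
    ext i'
    split_ifs with hb <;> simp [flaggedOrbit, hb]
  change (Y *ᵥ (Y *ᵥ fun i' => flaggedOrbit A B ψ t (b, i'))) i = _
  rw [h1, Matrix.mulVec_mulVec]
  split_ifs with hb
  · rw [h]; simp [flaggedOrbit, hb]
  · simp [flaggedOrbit, hb]

variable [DecidableEq ι]

theorem reflection_mul_self {P : Matrix ι ι ℂ} (hP2 : P * P = P) :
    ((2 : ℂ) • P - 1) * ((2 : ℂ) • P - 1) = 1 := by
  simp only [sub_mul, mul_sub, Matrix.smul_mul, Matrix.mul_smul, hP2, Matrix.one_mul,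
    Matrix.mul_one, smul_smul]
  module

/-- The reflection `2 P - 1` about the range of an orthogonal projection `P`. -/
def reflection (P : Matrix ι ι ℂ) (hP : Pᴴ = P) (hP2 : P * P = P) : Matrix.unitaryGroup ι ℂ :=
  ⟨(2 : ℂ) • P - 1, Matrix.mem_unitaryGroup_iff.2 (by
    rw [Matrix.star_eq_conjTranspose, reflection_conjTranspose hP, reflection_mul_self hP2])⟩

/-- One reflection moves `y (t+1)` forward; the other is the one that produced it and, being an
involution, moves it back. At the start the backward move is `B ψ = ψ`, which is why the orbit
begins with `ψ` twice. -/
theorem add_mulVec_alternatingOrbit (hA : A * A = 1) (hB : B * B = 1) (hψ : B *ᵥ ψ = ψ) (t : ℕ) :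
    (A + B) *ᵥ alternatingOrbit A B ψ (t + 1)
      = alternatingOrbit A B ψ (t + 2) + alternatingOrbit A B ψ t := by
  rcases t with _ | t
  · simp [alternatingOrbit, Matrix.add_mulVec, hψ]
  · have h : alternatingOrbit A B ψ (t + 1)
        = (if t.bodd then B else A) *ᵥ alternatingOrbit A B ψ (t + 1 + 1) := by
      conv_rhs => rw [alternatingOrbit, Matrix.mulVec_mulVec]
      split_ifs <;> simp [hA, hB]
    rw [alternatingOrbit.eq_3 A B ψ (t + 1)]
    conv_rhs => arg 2; rw [h]
    rw [← Matrix.add_mulVec]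
    cases ht : t.bodd <;> simp [Nat.bodd_succ, ht, add_comm]

/-- For involutions `(A + B)² = 2 + AB + BA`, which commutes with `A` and with `B`; an eigenvector
relation at `ψ` thus propagates along the orbit. -/
theorem sq_add_mulVec_alternatingOrbit (hA : A * A = 1) (hB : B * B = 1) {c : ℂ}
    (hψ : ((A + B) * (A + B)) *ᵥ ψ = c • ψ) (t : ℕ) :
    ((A + B) * (A + B)) *ᵥ alternatingOrbit A B ψ t = c • alternatingOrbit A B ψ t := by
  have hcA : ((A + B) * (A + B)) * A = A * ((A + B) * (A + B)) := by
    have e : (A + B) * (A + B) = 2 + A * B + B * A := by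
      rw [add_mul, mul_add, mul_add, hA, hB, ← one_add_one_eq_two]; abel
    rw [e]
    simp only [mul_add, add_mul, mul_two, two_mul]
    rw [mul_assoc B A A, hA, mul_assoc A B A, ← mul_assoc A A B, hA]
    simp only [mul_one, one_mul]; abel
  have hcB : ((A + B) * (A + B)) * B = B * ((A + B) * (A + B)) := by
    have e : (A + B) * (A + B) = 2 + A * B + B * A := by
      rw [add_mul, mul_add, mul_add, hA, hB, ← one_add_one_eq_two]; abel
    rw [e]
    simp only [mul_add, add_mul, mul_two, two_mul]
    rw [mul_assoc A B B, hB, mul_assoc B A B, ← mul_assoc B B A, hB]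
    simp only [mul_one, one_mul]; abel
  induction t using Nat.twoStepInduction with
  | zero => exact hψ
  | one => exact hψ
  | more t _ ih =>
    rw [alternatingOrbit, Matrix.mulVec_mulVec]
    split_ifs
    · rw [hcB, ← Matrix.mulVec_mulVec, ih, Matrix.mulVec_smul]
    · rw [hcA, ← Matrix.mulVec_mulVec, ih, Matrix.mulVec_smul]

theorem l2_alternatingOrbit (hA : Aᴴ * A = 1) (hB : Bᴴ * B = 1) (t : ℕ) :
    l2 (alternatingOrbit A B ψ t) = l2 ψ := by
  induction t using Nat.twoStepInduction with
  | zero => rfl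
  | one => rfl
  | more t _ ih =>
    rw [alternatingOrbit]
    split_ifs
    · rw [l2_mulVec_of_conjTranspose_mul_self hB, ih]
    · rw [l2_mulVec_of_conjTranspose_mul_self hA, ih]

theorem sum_reflections_mulVec {P : Matrix ι ι ℂ} (hψ : l2 ψ = 1) :
    (((2 : ℂ) • P - 1) + ((2 : ℂ) • Matrix.vecMulVec ψ (star ψ) - 1)) *ᵥ ψ
      = (2 : ℂ) • (P *ᵥ ψ) := by
  simp only [Matrix.add_mulVec, Matrix.sub_mulVec, Matrix.smul_mulVec, Matrix.one_mulVec,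
    Matrix.vecMulVec_mulVec, star_dotProduct_self_eq_one hψ]
  simp only [op_smul_eq_smul]
  module

/-- The first application gives `2 P ψ`. The vector `P ψ` is fixed by `2P - 1`, and the other
reflection sends it to `2⟨ψ, P ψ⟩ψ - P ψ`, so the sum is `2‖P ψ‖² ψ`. -/
theorem sq_sum_reflections_mulVec {P : Matrix ι ι ℂ} (hP : Pᴴ = P) (hP2 : P * P = P)
    (hψ : l2 ψ = 1) :
    ((((2 : ℂ) • P - 1) + ((2 : ℂ) • Matrix.vecMulVec ψ (star ψ) - 1)) *
      (((2 : ℂ) • P - 1) + ((2 : ℂ) • Matrix.vecMulVec ψ (star ψ) - 1))) *ᵥ ψ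
      = (4 * (l2 (P *ᵥ ψ) ^ 2 : ℝ) : ℂ) • ψ := by
  rw [← Matrix.mulVec_mulVec, sum_reflections_mulVec hψ, l2_sq_eq_dotProduct,
    star_mulVec_dotProduct_mulVec, hP, hP2]
  have hPP : P *ᵥ (P *ᵥ ψ) = P *ᵥ ψ := by rw [Matrix.mulVec_mulVec, hP2]
  simp only [Matrix.add_mulVec, Matrix.sub_mulVec, Matrix.smul_mulVec, Matrix.one_mulVec,
    Matrix.vecMulVec_mulVec, Matrix.mulVec_smul, hPP, op_smul_eq_smul]
  module

theorem l2_flaggedOrbit (hA : Aᴴ * A = 1) (hB : Bᴴ * B = 1) (t : ℕ) :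
    l2 (flaggedOrbit A B ψ t) = l2 ψ := by
  rw [← l2_alternatingOrbit hA hB t, ← pow_left_inj₀ (l2_nonneg _) (l2_nonneg _) two_ne_zero,
    l2_sq, l2_sq, Fintype.sum_prod_type]
  cases h : t.bodd <;> simp [flaggedOrbit, h]

/-- The indices `t` and `t + 2` share a parity opposite to that of `t + 1`, so flipping the flag is
consistent with the walk relation. -/
theorem flagFlip_mulVec_flaggedOrbit (hA : A * A = 1) (hB : B * B = 1) (hψ : B *ᵥ ψ = ψ) (t : ℕ) :
    flagFlip ((1 / 2 : ℂ) • (A + B)) *ᵥ flaggedOrbit A B ψ (t + 1)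
      = (1 / 2 : ℂ) • (flaggedOrbit A B ψ (t + 2) + flaggedOrbit A B ψ t) := by
  ext ⟨b, i⟩
  rw [flagFlip_mulVec, Matrix.smul_mulVec]
  have h : (fun i' => flaggedOrbit A B ψ (t + 1) (!b, i'))
      = if b = t.bodd then alternatingOrbit A B ψ (t + 1) else 0 := by
    ext i'
    cases b <;> cases ht : t.bodd <;> simp [flaggedOrbit, Nat.bodd_succ, ht]
  have h2 : (t + 2).bodd = t.bodd := by simp [Nat.bodd_succ]
  rw [h]
  by_cases hb : b = t.bodd
  · rw [if_pos hb, add_mulVec_alternatingOrbit hA hB hψ]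
    simp [flaggedOrbit, hb]
  · rw [if_neg hb]
    simp [flaggedOrbit, hb]

end Walk

/-- A walk that alternates the reflections about the range of `P` and about `ψ` estimates the length
of `P ψ`. -/
theorem exists_window_reflections (m : ℕ) :
    ∃ N, N = 2 * m + 1 ∧ ∃ f : Fin N → ℝ, ∑ t, f t ^ 2 = 1 ∧
      ∀ {ι : Type} [Fintype ι] [DecidableEq ι] (P : Matrix ι ι ℂ) (ψ : ι → ℂ),
        Pᴴ = P → P * P = P → l2 ψ = 1 →
        ∑ j, (|(pathMatrix_isHermitian N).eigenvalues j| - l2 (P *ᵥ ψ)) ^ 2 *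
          l2 (∑ t : Fin N, ((pathMatrix_isHermitian N).eigenvectorUnitary :
            Matrix _ _ ℂ)ᴴ j t • (f t : ℂ) • flaggedOrbit ((2 : ℂ) • P - 1)
              ((2 : ℂ) • Matrix.vecMulVec ψ (star ψ) - 1) ψ (t + 1)) ^ 2 ≤ 4 / (m + 1) ^ 2 := by
  obtain ⟨f, hf, h⟩ := exists_window m
  refine ⟨_, rfl, f, hf, fun {ι} _ _ P ψ hP hP2 hψ => ?_⟩
  set A := (2 : ℂ) • P - 1 with hA
  set B := (2 : ℂ) • Matrix.vecMulVec ψ (star ψ) - 1 with hB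
  have hAA : A * A = 1 := reflection_mul_self hP2
  have hBB : B * B = 1 := reflection_mul_self (rankOne_mul_self hψ)
  have hAH : Aᴴ = A := reflection_conjTranspose hP
  have hBH : Bᴴ = B := reflection_conjTranspose (rankOne_conjTranspose ψ)
  have hBψ : B *ᵥ ψ = ψ := by
    rw [hB]
    simp only [Matrix.sub_mulVec, Matrix.smul_mulVec, Matrix.one_mulVec,
      Matrix.vecMulVec_mulVec, star_dotProduct_self_eq_one hψ, op_smul_eq_smul]
    module
  refine h (flagFlip ((1 / 2 : ℂ) • (A + B))) (flaggedOrbit A B ψ) (l2 (P *ᵥ ψ)) (l2_nonneg _)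
    (fun t => ?_) (flagFlip_mulVec_flaggedOrbit hAA hBB hBψ)
    (fun t => (l2_flaggedOrbit (by rw [hAH, hAA]) (by rw [hBH, hBB]) t).trans hψ)
  have hY : ((1 / 2 : ℂ) • (A + B))ᴴ = (1 / 2 : ℂ) • (A + B) := by
    simp [Matrix.conjTranspose_smul, hAH, hBH]
  rw [flagFlip_conjTranspose, hY]
  refine sq_flagFlip_mulVec_flaggedOrbit ?_
  have h1 := sq_add_mulVec_alternatingOrbit hAA hBB (sq_sum_reflections_mulVec hP hP2 hψ) t
  rw [Matrix.smul_mul, Matrix.mul_smul, Matrix.smul_mulVec, Matrix.smul_mulVec, h1, smul_smul,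
    smul_smul]
  congr 1
  ring

/-- Every unit vector is the image of a given computational basis state under some unitary. -/
theorem exists_unitary_mulVec_single {ι : Type*} [Fintype ι] [DecidableEq ι] (i₀ : ι) {v : ι → ℂ}
    (hv : l2 v = 1) : ∃ U : Matrix.unitaryGroup ι ℂ, U.1 *ᵥ Pi.single i₀ 1 = v := by
  obtain ⟨b, hb⟩ := Orthonormal.exists_orthonormalBasis_extension_of_card_eq (𝕜 := ℂ)
    (E := EuclideanSpace ℂ ι) (ι := ι) (by simp) (v := fun _ => WithLp.toLp 2 v) (s := {i₀}) (by
      refine ⟨fun i => hv, fun i j hij => ?_⟩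
      exact absurd (Subsingleton.elim i j) hij)
  refine ⟨⟨(EuclideanSpace.basisFun ι ℂ).toBasis.toMatrix b,
    OrthonormalBasis.toMatrix_orthonormalBasis_mem_unitary _ _⟩, ?_⟩
  ext i
  simp [Module.Basis.toMatrix_apply, hb i₀ rfl]

/-! ### Circuits, their inverses and query counts -/

namespace QueryStep

variable {k l n : ℕ} {W : Type} [Fintype W] [DecidableEq W]

/-- The step that undoes a given step. -/
def inv : QueryStep k l n W → QueryStep k l n W
  | gate V => gate V⁻¹
  | query .rho => query .rhoInv
  | query .rhoInv => query .rho
  | query .sigma => query .sigmaInv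
  | query .sigmaInv => query .sigma

variable (Uρ : Matrix.unitaryGroup (Fin k × Fin n) ℂ) (Uσ : Matrix.unitaryGroup (Fin l × Fin n) ℂ)

theorem toMatrix_inv (s : QueryStep k l n W) : s.inv.toMatrix Uρ Uσ = (s.toMatrix Uρ Uσ)ᴴ := by
  rcases s with V | o
  · rfl
  · cases o <;> simp [inv, toMatrix, Matrix.conjTranspose_kronecker]

theorem isQuery_inv (s : QueryStep k l n W) : s.inv.isQuery = s.isQuery := by
  rcases s with V | o
  · rfl
  · cases o <;> rfl

theorem conjTranspose_mul_self (s : QueryStep k l n W) :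
    (s.toMatrix Uρ Uσ)ᴴ * s.toMatrix Uρ Uσ = 1 := by
  have h1 : Uρ.1ᴴ * Uρ.1 = 1 := Unitary.star_mul_self_of_mem Uρ.2
  have h2 : Uρ.1 * Uρ.1ᴴ = 1 := Unitary.mul_star_self_of_mem Uρ.2
  have h3 : Uσ.1ᴴ * Uσ.1 = 1 := Unitary.star_mul_self_of_mem Uσ.2
  have h4 : Uσ.1 * Uσ.1ᴴ = 1 := Unitary.mul_star_self_of_mem Uσ.2
  rcases s with V | o
  · exact Unitary.star_mul_self_of_mem V.2
  · cases o <;> simp [toMatrix, Matrix.conjTranspose_kronecker, ← Matrix.mul_kronecker_mul, h1, h2,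
      h3, h4]

theorem query_rho_mulVec (U : Matrix (Fin k × Fin n) (Fin k × Fin n) ℂ)
    (v : Memory k l n W → ℂ) (x : Fin k × Fin n) (z : (Fin l × Fin n) × W) :
    ((U ⊗ₖ (1 : Matrix ((Fin l × Fin n) × W) ((Fin l × Fin n) × W) ℂ)) *ᵥ v) (x, z)
      = (U *ᵥ fun x' => v (x', z)) x := by
  simp only [Matrix.mulVec, dotProduct, Fintype.sum_prod_type (α₁ := Fin k × Fin n),
    Matrix.kroneckerMap_apply, Matrix.one_apply]
  simp

theorem query_sigma_mulVec (U : Matrix (Fin l × Fin n) (Fin l × Fin n) ℂ)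
    (v : Memory k l n W → ℂ) (x : Fin k × Fin n) (y : Fin l × Fin n) (w : W) :
    (((1 : Matrix (Fin k × Fin n) (Fin k × Fin n) ℂ) ⊗ₖ (U ⊗ₖ (1 : Matrix W W ℂ))) *ᵥ v) (x, (y, w))
      = (U *ᵥ fun y' => v (x, (y', w))) y := by
  simp only [Matrix.mulVec, dotProduct, Fintype.sum_prod_type (α₁ := Fin k × Fin n),
    Fintype.sum_prod_type (α₁ := Fin l × Fin n),
    Matrix.kroneckerMap_apply, Matrix.one_apply]
  simp

end QueryStep

section Circuit

variable {k l n : ℕ} {W : Type} [Fintype W] [DecidableEq W]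
variable (Uρ : Matrix.unitaryGroup (Fin k × Fin n) ℂ) (Uσ : Matrix.unitaryGroup (Fin l × Fin n) ℂ)

/-- The operator applied by a sequence of steps. -/
def circuitMatrix : List (QueryStep k l n W) → Matrix (Memory k l n W) (Memory k l n W) ℂ
  | [] => 1
  | s :: L => circuitMatrix L * s.toMatrix Uρ Uσ

theorem foldl_toMatrix_mulVec (L : List (QueryStep k l n W)) (v : Memory k l n W → ℂ) :
    L.foldl (fun v s => s.toMatrix Uρ Uσ *ᵥ v) v = circuitMatrix Uρ Uσ L *ᵥ v := by
  induction L generalizing v with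
  | nil => simp [circuitMatrix]
  | cons s L ih => rw [List.foldl_cons, ih, circuitMatrix, Matrix.mulVec_mulVec]

theorem circuitMatrix_append (L L' : List (QueryStep k l n W)) :
    circuitMatrix Uρ Uσ (L ++ L') = circuitMatrix Uρ Uσ L' * circuitMatrix Uρ Uσ L := by
  induction L with
  | nil => simp [circuitMatrix]
  | cons s L ih => rw [List.cons_append, circuitMatrix, ih, circuitMatrix, Matrix.mul_assoc]

theorem circuitMatrix_singleton (s : QueryStep k l n W) :
    circuitMatrix Uρ Uσ [s] = s.toMatrix Uρ Uσ := by
  simp [circuitMatrix]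

theorem circuitMatrix_conjTranspose_mul_self (L : List (QueryStep k l n W)) :
    (circuitMatrix Uρ Uσ L)ᴴ * circuitMatrix Uρ Uσ L = 1 := by
  induction L with
  | nil => simp [circuitMatrix]
  | cons s L ih =>
    rw [circuitMatrix, Matrix.conjTranspose_mul, Matrix.mul_assoc, ← Matrix.mul_assoc _ᴴ _ᴴ,
      Matrix.mul_assoc, ← Matrix.mul_assoc _ _ (s.toMatrix Uρ Uσ), ih, Matrix.one_mul,
      s.conjTranspose_mul_self]

/-- The sequence of steps that undoes a given one. -/
def inverseCircuit : List (QueryStep k l n W) → List (QueryStep k l n W)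
  | [] => []
  | s :: L => inverseCircuit L ++ [s.inv]

theorem circuitMatrix_inverseCircuit (L : List (QueryStep k l n W)) :
    circuitMatrix Uρ Uσ (inverseCircuit L) = (circuitMatrix Uρ Uσ L)ᴴ := by
  induction L with
  | nil => simp [inverseCircuit, circuitMatrix]
  | cons s L ih =>
    rw [inverseCircuit, circuitMatrix_append, circuitMatrix_singleton, QueryStep.toMatrix_inv, ih,
      circuitMatrix, Matrix.conjTranspose_mul]

theorem countP_inverseCircuit (L : List (QueryStep k l n W)) :
    (inverseCircuit L).countP QueryStep.isQuery = L.countP QueryStep.isQuery := by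
  induction L with
  | nil => rfl
  | cons s L ih =>
    rw [inverseCircuit, List.countP_append, ih, List.countP_singleton, List.countP_cons,
      s.isQuery_inv]

end Circuit

/-! ### Control registers and counters -/

section Control

variable {k l n : ℕ} {W C : Type} [Fintype W] [DecidableEq W] [Fintype C] [DecidableEq C]

/-- The part of a state of the extended memory in which the control register has a given value. -/
def slice (Ψ : Memory k l n (C × W) → ℂ) (c : C) : Memory k l n W → ℂ :=
  fun p => Ψ (p.1, (p.2.1, (c, p.2.2)))

/-- Splitting the control register off the memory. -/
def controlEquiv (k l n : ℕ) (W C : Type) : Memory k l n (C × W) ≃ Memory k l n W × C where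
  toFun p := ((p.1, (p.2.1, p.2.2.2)), p.2.2.1)
  invFun q := (q.1.1, (q.1.2.1, (q.2, q.1.2.2)))
  left_inv _ := rfl
  right_inv _ := rfl

/-- The gate that applies a unitary chosen by the value of the control register. -/
def controlledGate (V : C → Matrix.unitaryGroup (Memory k l n W) ℂ) :
    Matrix.unitaryGroup (Memory k l n (C × W)) ℂ :=
  ⟨(Matrix.blockDiagonal fun c => (V c).1).submatrix (controlEquiv k l n W C)
      (controlEquiv k l n W C), Matrix.mem_unitaryGroup_iff.2 (by
    rw [Matrix.star_eq_conjTranspose, Matrix.conjTranspose_submatrix, Matrix.submatrix_mul_equiv,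
      Matrix.blockDiagonal_conjTranspose, ← Matrix.blockDiagonal_mul]
    have : (fun c => (V c).1 * (V c).1ᴴ) = 1 :=
      funext fun c => Unitary.mul_star_self_of_mem (V c).2
    rw [this, Matrix.blockDiagonal_one, Matrix.submatrix_one_equiv])⟩

theorem slice_controlledGate_mulVec (V : C → Matrix.unitaryGroup (Memory k l n W) ℂ)
    (Ψ : Memory k l n (C × W) → ℂ) (c : C) :
    slice ((controlledGate V).1 *ᵥ Ψ) c = (V c).1 *ᵥ slice Ψ c := by
  ext p
  change ((Matrix.blockDiagonal fun c => (V c).1).submatrix (controlEquiv k l n W C)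
    (controlEquiv k l n W C) *ᵥ Ψ) ((controlEquiv k l n W C).symm (p, c)) = _
  rw [Matrix.submatrix_mulVec_equiv, Function.comp_apply, Equiv.apply_symm_apply]
  simp only [Matrix.mulVec, dotProduct, Fintype.sum_prod_type (α₂ := C),
    Matrix.blockDiagonal_apply, ite_mul, zero_mul]
  simp [slice, controlEquiv]

/-- A step performed on the memory without the control register. -/
def QueryStep.lift (C : Type) [Fintype C] [DecidableEq C] :
    QueryStep k l n W → QueryStep k l n (C × W)
  | gate V => gate (controlledGate fun _ => V)
  | query o => query o

theorem QueryStep.isQuery_lift (s : QueryStep k l n W) : (s.lift C).isQuery = s.isQuery := by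
  cases s <;> rfl

variable (Uρ : Matrix.unitaryGroup (Fin k × Fin n) ℂ) (Uσ : Matrix.unitaryGroup (Fin l × Fin n) ℂ)

theorem QueryStep.slice_lift_mulVec (s : QueryStep k l n W) (Ψ : Memory k l n (C × W) → ℂ)
    (c : C) : slice ((s.lift C).toMatrix Uρ Uσ *ᵥ Ψ) c = s.toMatrix Uρ Uσ *ᵥ slice Ψ c := by
  rcases s with V | o
  · exact slice_controlledGate_mulVec _ _ _
  · ext ⟨x, y, w⟩
    cases o <;> simp only [lift, toMatrix, slice, query_rho_mulVec, query_sigma_mulVec]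

theorem slice_circuitMatrix_lift_mulVec (L : List (QueryStep k l n W))
    (Ψ : Memory k l n (C × W) → ℂ) (c : C) :
    slice (circuitMatrix Uρ Uσ (L.map (QueryStep.lift C)) *ᵥ Ψ) c
      = circuitMatrix Uρ Uσ L *ᵥ slice Ψ c := by
  induction L generalizing Ψ with
  | nil => simp [circuitMatrix]
  | cons s L ih =>
    rw [List.map_cons, circuitMatrix, ← Matrix.mulVec_mulVec, ih, s.slice_lift_mulVec,
      circuitMatrix, Matrix.mulVec_mulVec]

theorem countP_lift (L : List (QueryStep k l n W)) :
    (L.map (QueryStep.lift C)).countP QueryStep.isQuery = L.countP QueryStep.isQuery := by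
  rw [List.countP_map]
  congr 1
  funext s
  exact s.isQuery_lift

/-- Splitting the first part of the control register off the memory. -/
def counterEquiv (k l n : ℕ) (W I : Type) :
    Memory k l n ((I × Bool) × W) ≃ I × (Bool × Memory k l n W) where
  toFun p := (p.2.2.1.1, (p.2.2.1.2, (p.1, (p.2.1, p.2.2.2))))
  invFun q := (q.2.2.1, (q.2.2.2.1, ((q.1, q.2.1), q.2.2.2.2)))
  left_inv _ := rfl
  right_inv _ := rfl

variable {I : Type} [Fintype I] [DecidableEq I]

/-- The gate that applies a unitary to the first part of the control register. -/
def counterGate (V : Matrix.unitaryGroup I ℂ) :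
    Matrix.unitaryGroup (Memory k l n ((I × Bool) × W)) ℂ :=
  ⟨(V.1 ⊗ₖ (1 : Matrix (Bool × Memory k l n W) (Bool × Memory k l n W) ℂ)).submatrix
      (counterEquiv k l n W I) (counterEquiv k l n W I), Matrix.mem_unitaryGroup_iff.2 (by
    have h : V.1 * V.1ᴴ = 1 := Unitary.mul_star_self_of_mem V.2
    rw [Matrix.star_eq_conjTranspose, Matrix.conjTranspose_submatrix, Matrix.submatrix_mul_equiv,
      Matrix.conjTranspose_kronecker, ← Matrix.mul_kronecker_mul, h]
    simp)⟩

theorem counterGate_mulVec (V : Matrix.unitaryGroup I ℂ)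
    (Ψ : Memory k l n ((I × Bool) × W) → ℂ) (j : I) (q : Bool × Memory k l n W) :
    ((counterGate V).1 *ᵥ Ψ) ((counterEquiv k l n W I).symm (j, q))
      = ∑ t, V.1 j t * slice Ψ (t, q.1) q.2 := by
  change ((V.1 ⊗ₖ (1 : Matrix (Bool × Memory k l n W) (Bool × Memory k l n W) ℂ)).submatrix
    (counterEquiv k l n W I) (counterEquiv k l n W I) *ᵥ Ψ)
      ((counterEquiv k l n W I).symm (j, q)) = _
  rw [Matrix.submatrix_mulVec_equiv, Function.comp_apply, Equiv.apply_symm_apply]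
  simp only [Matrix.mulVec, dotProduct, Fintype.sum_prod_type (α₁ := I),
    Matrix.kroneckerMap_apply, Matrix.one_apply, mul_ite, mul_one, mul_zero, ite_mul, zero_mul,
    Finset.sum_ite_eq, Finset.mem_univ, if_true]
  rfl

end Control

/-! ### The controlled walk as a circuit -/

section WalkCircuit

variable {k l n : ℕ} {W : Type} [Fintype W] [DecidableEq W] {N : ℕ}

/-- One step of the controlled walk: with the counter in state `t`, the reflection number `s` is
applied if and only if `s < t`. The reflections are `A` and the conjugate of `B` by the
circuit `L`, in turn. -/
def walkStep (N : ℕ) (L : List (QueryStep k l n W))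
    (A B : Matrix.unitaryGroup (Memory k l n W) ℂ) (s : ℕ) :
    List (QueryStep k l n ((Fin N × Bool) × W)) :=
  if s.bodd then
    (inverseCircuit L).map (QueryStep.lift (Fin N × Bool)) ++
      (QueryStep.gate (controlledGate fun c => if s < (c.1 : ℕ) then B else 1) ::
        L.map (QueryStep.lift (Fin N × Bool)))
  else [QueryStep.gate (controlledGate fun c => if s < (c.1 : ℕ) then A else 1)]

/-- The first `K` steps of the controlled walk. -/
def walkCircuit (N : ℕ) (L : List (QueryStep k l n W))
    (A B : Matrix.unitaryGroup (Memory k l n W) ℂ) :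
    ℕ → List (QueryStep k l n ((Fin N × Bool) × W))
  | 0 => []
  | K + 1 => walkCircuit N L A B K ++ walkStep N L A B K

theorem countP_walkCircuit_le (L : List (QueryStep k l n W))
    (A B : Matrix.unitaryGroup (Memory k l n W) ℂ) (K : ℕ) :
    (walkCircuit N L A B K).countP QueryStep.isQuery ≤ K * (2 * L.countP QueryStep.isQuery) := by
  induction K with
  | zero => simp [walkCircuit]
  | succ K ih =>
    rw [walkCircuit, List.countP_append, Nat.succ_mul]
    refine Nat.add_le_add ih ?_
    rw [walkStep]
    split_ifs
    · rw [List.countP_append, List.countP_cons, countP_lift, countP_lift, countP_inverseCircuit]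
      simp [QueryStep.isQuery, two_mul]
    · simp [QueryStep.isQuery]

variable (Uρ : Matrix.unitaryGroup (Fin k × Fin n) ℂ) (Uσ : Matrix.unitaryGroup (Fin l × Fin n) ℂ)

/-- Only the middle reflection is controlled. When it is skipped, the surrounding circuit and its
inverse cancel, so no controlled queries are needed. -/
theorem slice_walkStep_mulVec (L : List (QueryStep k l n W))
    (A B : Matrix.unitaryGroup (Memory k l n W) ℂ) (s : ℕ)
    (Ψ : Memory k l n ((Fin N × Bool) × W) → ℂ) (c : Fin N × Bool) :
    slice (circuitMatrix Uρ Uσ (walkStep N L A B s) *ᵥ Ψ) c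
      = if s < (c.1 : ℕ) then
          (if s.bodd then circuitMatrix Uρ Uσ L * B.1 * (circuitMatrix Uρ Uσ L)ᴴ else A.1) *ᵥ
            slice Ψ c
        else slice Ψ c := by
  have hQ := mul_eq_one_comm.1 (circuitMatrix_conjTranspose_mul_self Uρ Uσ L)
  cases hs : s.bodd
  · simp only [walkStep, hs, Bool.false_eq_true, if_false, circuitMatrix_singleton,
      QueryStep.toMatrix, slice_controlledGate_mulVec]
    split_ifs <;> simp
  · simp only [walkStep, hs, if_true, circuitMatrix_append, circuitMatrix, QueryStep.toMatrix,
      ← Matrix.mulVec_mulVec, slice_circuitMatrix_lift_mulVec, slice_controlledGate_mulVec,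
      circuitMatrix_inverseCircuit]
    split_ifs
    · rfl
    · rw [OneMemClass.coe_one, Matrix.one_mulVec, Matrix.mulVec_mulVec, hQ, Matrix.one_mulVec]

/-- In the branch with counter `t`, exactly the reflections numbered below `t` act, so the walk
stops after `min t K` steps; the shift by one reflects that index `1` is `ψ`. -/
theorem slice_walkCircuit_mulVec (L : List (QueryStep k l n W))
    (A B : Matrix.unitaryGroup (Memory k l n W) ℂ) (K : ℕ)
    {Ψ : Memory k l n ((Fin N × Bool) × W) → ℂ} {z : Fin N × Bool → ℂ} {ψ : Memory k l n W → ℂ}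
    (hΨ : ∀ c, slice Ψ c = z c • ψ) (c : Fin N × Bool) :
    slice (circuitMatrix Uρ Uσ (walkCircuit N L A B K) *ᵥ Ψ) c
      = z c • alternatingOrbit A.1 (circuitMatrix Uρ Uσ L * B.1 * (circuitMatrix Uρ Uσ L)ᴴ) ψ
          (min (c.1 : ℕ) K + 1) := by
  induction K with
  | zero => simp [walkCircuit, circuitMatrix, hΨ, alternatingOrbit]
  | succ K ih =>
    rw [walkCircuit, circuitMatrix_append, ← Matrix.mulVec_mulVec, slice_walkStep_mulVec, ih]
    by_cases h : K < (c.1 : ℕ)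
    · rw [if_pos h, min_eq_right h.le, min_eq_right (Nat.succ_le_of_lt h), Matrix.mulVec_smul,
        alternatingOrbit]
    · rw [if_neg h, min_eq_left (not_lt.1 h), min_eq_left (by omega)]

end WalkCircuit

/-! ### Amplitude discrimination -/

/-- A random variable with small mean square deviation from `a` allows one to decide
whether `a` is large. -/
theorem two_thirds_le_sum_filter {J : Type*} [Fintype J] {g x : J → ℝ} (hg : ∀ j, 0 ≤ g j)
    (hg1 : ∑ j, g j = 1) {a α δ κ : ℝ} (hδ : 0 < δ) (hκ : 12 * κ ≤ δ ^ 2)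
    (h : ∑ j, (x j - a) ^ 2 * g j ≤ κ) :
    (α ≤ a → 2 / 3 ≤ ∑ j with decide (α - δ / 2 ≤ x j) = true, g j) ∧
      (a ≤ α - δ → 2 / 3 ≤ ∑ j with decide (α - δ / 2 ≤ x j) = false, g j) := by
  -- Chebyshev: outside the correct outcomes the deviation is at least `δ/2`, so their complement
  -- has mass at most `4κ/δ² ≤ 1/3`.
  have key : ∀ s : Finset J, (∀ j ∉ s, (δ / 2) ^ 2 ≤ (x j - a) ^ 2) → 2 / 3 ≤ ∑ j ∈ s, g j := by
    classical
    intro s hs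
    have h1 : (δ / 2) ^ 2 * ∑ j ∈ sᶜ, g j ≤ κ := by
      rw [Finset.mul_sum]
      refine le_trans ?_ h
      refine (Finset.sum_le_sum fun j hj => ?_).trans
        (Finset.sum_le_univ_sum_of_nonneg fun j => mul_nonneg (sq_nonneg _) (hg j))
      exact mul_le_mul_of_nonneg_right (hs j (Finset.mem_compl.1 hj)) (hg j)
    have h2 := Finset.sum_add_sum_compl s g
    rw [hg1] at h2
    have h3 : 0 < δ ^ 2 := by positivity
    by_contra! h4
    have h5 : 1 / 3 < ∑ j ∈ sᶜ, g j := by linarith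
    nlinarith
  constructor
  · intro ha
    refine key _ fun j hj => ?_
    have : x j < α - δ / 2 := not_le.1 (by simpa [-not_le, -tsub_le_iff_right] using hj)
    nlinarith
  · intro ha
    refine key _ fun j hj => ?_
    have : α - δ / 2 ≤ x j := by simpa using hj
    nlinarith

/-- This makes the reflection about the unknown state `ψ` implementable: undo the circuit, reflect
about the known `η`, redo the circuit. -/
theorem rankOne_conj {ι : Type*} [Fintype ι] [DecidableEq ι] {Q : Matrix ι ι ℂ} (hQ : Qᴴ * Q = 1)
    (η : ι → ℂ) :
    Q * ((2 : ℂ) • Matrix.vecMulVec η (star η) - 1) * Qᴴ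
      = (2 : ℂ) • Matrix.vecMulVec (Q *ᵥ η) (star (Q *ᵥ η)) - 1 := by
  rw [Matrix.mul_sub, Matrix.sub_mul, Matrix.mul_one, mul_eq_one_comm.1 hQ, Matrix.mul_smul,
    Matrix.smul_mul, Matrix.mul_vecMulVec, Matrix.vecMulVec_mul, Matrix.star_mulVec]

/-- Amplitude discrimination: if a circuit `L` with `q` queries maps `η` to `ψ`, then `O(q / δ)`
queries suffice to decide whether `‖P ψ‖ ≥ α` or `‖P ψ‖ ≤ α - δ`. -/
theorem exists_algorithm_of_circuit {k l n : ℕ} {W : Type} [Fintype W] [DecidableEq W]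
    (L : List (QueryStep k l n W)) {η : Memory k l n W → ℂ} (hη : l2 η = 1)
    {P : Matrix (Memory k l n W) (Memory k l n W) ℂ} (hP : Pᴴ = P) (hP2 : P * P = P)
    {α δ : ℝ} (hδ : 0 < δ) (hδ1 : δ ≤ 1) :
    ∃ 𝒜 : QueryAlgorithm k l n,
      (𝒜.queryCount : ℝ) ≤ 35 * L.countP QueryStep.isQuery / δ ∧
      ∀ (Uρ : Matrix.unitaryGroup (Fin k × Fin n) ℂ) (Uσ : Matrix.unitaryGroup (Fin l × Fin n) ℂ),
        (α ≤ l2 (P *ᵥ (circuitMatrix Uρ Uσ L *ᵥ η)) → 2 / 3 ≤ 𝒜.outputProb Uρ Uσ true) ∧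
        (l2 (P *ᵥ (circuitMatrix Uρ Uσ L *ᵥ η)) ≤ α - δ → 2 / 3 ≤ 𝒜.outputProb Uρ Uσ false) := by
  -- The dimensions may be zero here, but an empty memory carries no unit vector.
  obtain ⟨p₀⟩ : Nonempty (Memory k l n W) := by
    by_contra h
    rw [not_nonempty_iff] at h
    have := l2_sq η
    simp [hη] at this
  set m : ℕ := ⌈7 / δ⌉₊ with hm
  have hm1 : 7 / δ ≤ m := Nat.le_ceil _
  have hm2 : (m : ℝ) ≤ 8 / δ := by
    have h1 : (m : ℝ) < 7 / δ + 1 := Nat.ceil_lt_add_one (by positivity)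
    have h2 : 1 ≤ 1 / δ := by rw [le_div_iff₀ hδ]; linarith
    have h3 : 8 / δ = 7 / δ + 1 / δ := by ring
    linarith
  obtain ⟨N, hN, f, hf, hwin⟩ := exists_window_reflections m
  have hN0 : 0 < N := by omega
  -- The flag starts at the parity of `t + 1`, the index that the orbit reaches in the branch `t`;
  -- the walk itself never touches it.
  let z : Fin N × Bool → ℂ := fun c => if c.2 = ((c.1 : ℕ) + 1).bodd then (f c.1 : ℂ) else 0
  let Ψ₀ : Memory k l n ((Fin N × Bool) × W) → ℂ := fun p => z p.2.2.1 * η (p.1, (p.2.1, p.2.2.2))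
  have hΨ₀ : l2 Ψ₀ = 1 := by
    rw [← pow_left_inj₀ (l2_nonneg _) zero_le_one two_ne_zero, l2_sq,
      ← Equiv.sum_comp (controlEquiv k l n W (Fin N × Bool)).symm, Fintype.sum_prod_type_right]
    have h1 : ∀ c : Fin N × Bool, ∑ p : Memory k l n W,
        ‖Ψ₀ ((controlEquiv k l n W (Fin N × Bool)).symm (p, c))‖ ^ 2 = ‖z c‖ ^ 2 := by
      intro c
      have h2 := l2_sq η
      rw [hη] at h2
      calc _ = ∑ p, ‖z c‖ ^ 2 * ‖η p‖ ^ 2 :=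
            Finset.sum_congr rfl fun p _ => by rw [← mul_pow, ← norm_mul]; rfl
        _ = _ := by rw [← Finset.mul_sum, ← h2]; simp
    rw [Finset.sum_congr rfl fun c _ => h1 c, Fintype.sum_prod_type, one_pow, ← hf]
    refine Finset.sum_congr rfl fun t _ => ?_
    simp only [z]
    generalize ((t : ℕ) + 1).bodd = b
    cases b <;> simp
  -- The whole initial superposition is prepared by one gate that makes no queries.
  obtain ⟨U, hU⟩ := exists_unitary_mulVec_single
    (((p₀.1, (p₀.2.1, ((⟨0, hN0⟩, false), p₀.2.2)))) : Memory k l n ((Fin N × Bool) × W)) hΨ₀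
  set hM := pathMatrix_isHermitian N with hMdef
  set B := reflection _ (rankOne_conjTranspose η) (rankOne_mul_self hη) with hB
  let 𝒜 : QueryAlgorithm k l n :=
    { W := (Fin N × Bool) × W
      fintypeW := inferInstance
      decidableEqW := inferInstance
      start := (p₀.1, (p₀.2.1, ((⟨0, hN0⟩, false), p₀.2.2)))
      steps := QueryStep.gate U :: (L.map (QueryStep.lift (Fin N × Bool)) ++
        (walkCircuit N L (reflection P hP hP2) B N ++
          [QueryStep.gate (counterGate hM.eigenvectorUnitary⁻¹)]))
      output := fun p => decide (α - δ / 2 ≤ |hM.eigenvalues p.2.2.1.1|) }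
  refine ⟨𝒜, ?_, fun Uρ Uσ => ?_⟩
  · have h1 : 𝒜.queryCount ≤ L.countP QueryStep.isQuery
        + N * (2 * L.countP QueryStep.isQuery) := by
      have h2 := countP_walkCircuit_le (N := N) L (reflection P hP hP2) B N
      simp only [QueryAlgorithm.queryCount, 𝒜, List.countP_cons, List.countP_append, countP_lift,
        List.countP_nil, QueryStep.isQuery]
      simpa using h2
    have h2 : (𝒜.queryCount : ℝ) ≤ (L.countP QueryStep.isQuery : ℕ)
        + N * (2 * (L.countP QueryStep.isQuery : ℕ)) := by exact_mod_cast h1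
    refine h2.trans ?_
    rw [hN]
    push_cast
    -- One preparation and at most `2q` queries for each of `2m + 1` walk steps make `(4m + 3) q` in
    -- total.
    have h3 : (4 * (m : ℝ) + 3) ≤ 35 / δ := by
      have h2 : 1 ≤ 1 / δ := by rw [le_div_iff₀ hδ]; linarith
      have h3 : 35 / δ = 4 * (8 / δ) + 3 * (1 / δ) := by ring
      linarith
    calc _ = (4 * (m : ℝ) + 3) * (L.countP QueryStep.isQuery : ℕ) := by ring
      _ ≤ 35 / δ * (L.countP QueryStep.isQuery : ℕ) := by gcongr
      _ = _ := by ring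
  · set Q := circuitMatrix Uρ Uσ L with hQdef
    have hQ : Qᴴ * Q = 1 := circuitMatrix_conjTranspose_mul_self Uρ Uσ L
    set ψ := Q *ᵥ η with hψdef
    have hψ : l2 ψ = 1 := (l2_mulVec_of_conjTranspose_mul_self hQ η).trans hη
    let X : Fin N → Bool × Memory k l n W → ℂ := fun t =>
      (f t : ℂ) • flaggedOrbit ((2 : ℂ) • P - 1) ((2 : ℂ) • Matrix.vecMulVec ψ (star ψ) - 1) ψ
        (t + 1)
    let Y : Fin N → Bool × Memory k l n W → ℂ := fun j =>
      ∑ t, hM.eigenvectorUnitary.1ᴴ j t • X t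
    have hY : ∑ j, (|hM.eigenvalues j| - l2 (P *ᵥ ψ)) ^ 2 * l2 (Y j) ^ 2 ≤ 4 / (m + 1) ^ 2 :=
      hwin P ψ hP hP2 hψ
    have hY1 : ∑ j, l2 (Y j) ^ 2 = 1 := by
      have hV : hM.eigenvectorUnitary.1ᴴᴴ * hM.eigenvectorUnitary.1ᴴ
          = 1 := by
        rw [Matrix.conjTranspose_conjTranspose]
        exact Unitary.mul_star_self_of_mem hM.eigenvectorUnitary.2
      rw [sum_l2_sq_unitary_combination hV, ← hf]
      refine Finset.sum_congr rfl fun t _ => ?_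
      have hA1 : ((2 : ℂ) • P - 1)ᴴ * ((2 : ℂ) • P - 1) = 1 := by
        rw [reflection_conjTranspose hP, reflection_mul_self hP2]
      have hB1 : ((2 : ℂ) • Matrix.vecMulVec ψ (star ψ) - 1)ᴴ *
          ((2 : ℂ) • Matrix.vecMulVec ψ (star ψ) - 1) = 1 := by
        rw [reflection_conjTranspose (rankOne_conjTranspose ψ),
          reflection_mul_self (rankOne_mul_self hψ)]
      simp only [X, l2_smul, l2_flaggedOrbit hA1 hB1, hψ, mul_one, Complex.norm_real,
        Real.norm_eq_abs, sq_abs]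
    -- The last gate turns the counter basis into the eigenbasis of the path matrix, so the final
    -- amplitudes are those whose concentration was shown.
    have hfinal : ∀ j q, 𝒜.finalState Uρ Uσ ((counterEquiv k l n W (Fin N)).symm (j, q))
        = Y j q := by
      intro j q
      have h0 : ∀ c, slice (circuitMatrix Uρ Uσ (L.map (QueryStep.lift (Fin N × Bool))) *ᵥ Ψ₀) c
          = z c • ψ := by
        intro c
        rw [slice_circuitMatrix_lift_mulVec, hψdef, ← Matrix.mulVec_smul]
        rfl
      have h1 := slice_walkCircuit_mulVec Uρ Uσ L (reflection P hP hP2) B N h0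
      have h2 : 𝒜.finalState Uρ Uσ = (counterGate hM.eigenvectorUnitary⁻¹).1 *ᵥ
          (circuitMatrix Uρ Uσ (walkCircuit N L (reflection P hP hP2) B N) *ᵥ
            (circuitMatrix Uρ Uσ (L.map (QueryStep.lift (Fin N × Bool))) *ᵥ Ψ₀)) := by
        rw [QueryAlgorithm.finalState, foldl_toMatrix_mulVec]
        simp only [𝒜, circuitMatrix, circuitMatrix_append, QueryStep.toMatrix, Matrix.one_mul,
          ← Matrix.mulVec_mulVec, hU]
      rw [h2, counterGate_mulVec]
      simp only [Y, Finset.sum_apply, Pi.smul_apply, smul_eq_mul]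
      refine Finset.sum_congr rfl fun t _ => ?_
      rw [h1, min_eq_left t.2.le]
      have hBB : Q * B.1 * Qᴴ = (2 : ℂ) • Matrix.vecMulVec ψ (star ψ) - 1 := rankOne_conj hQ η
      rw [hBB]
      simp only [X, flaggedOrbit, z, Pi.smul_apply, smul_eq_mul]
      congr 1
      split_ifs <;> simp [reflection]
    have hprob : ∀ b, 𝒜.outputProb Uρ Uσ b
        = ∑ j with decide (α - δ / 2 ≤ |hM.eigenvalues j|) = b, l2 (Y j) ^ 2 := by
      intro b
      rw [QueryAlgorithm.outputProb, Finset.sum_filter, Finset.sum_filter,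
        ← Equiv.sum_comp (counterEquiv k l n W (Fin N)).symm, Fintype.sum_prod_type]
      refine Finset.sum_congr rfl fun j _ => ?_
      rw [l2_sq]
      change (∑ q, if decide (α - δ / 2 ≤ |hM.eigenvalues j|) = b then _ else _) = _
      split_ifs
      · exact Finset.sum_congr rfl fun q _ => by rw [hfinal]
      · simp
    rw [hprob, hprob]
    refine two_thirds_le_sum_filter (fun j => sq_nonneg _) hY1 hδ ?_ hY
    have h7 : 7 ≤ δ * (m + 1) := by
      rw [div_le_iff₀ hδ] at hm1
      nlinarith
    rw [← mul_div_assoc, div_le_iff₀ (by positivity), ← mul_pow]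
    nlinarith

/-! ### The Hilbert–Schmidt norm and purifications -/

theorem schattenNorm_two_nonneg {n : ℕ} (A : Matrix (Fin n) (Fin n) ℂ) : 0 ≤ schattenNorm 2 A :=
  Real.rpow_nonneg (Finset.sum_nonneg fun _ _ => Real.rpow_nonneg (Real.sqrt_nonneg _) _) _

/-- The squared singular values sum to the trace of `Aᴴ * A`, which is the sum of squared moduli of
the entries. -/
theorem schattenNorm_two_sq {n : ℕ} (A : Matrix (Fin n) (Fin n) ℂ) :
    schattenNorm 2 A ^ 2 = ∑ i, ∑ j, ‖A i j‖ ^ 2 := by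
  have hH := Matrix.isHermitian_conjTranspose_mul_self A
  have h1 : schattenNorm 2 A = √(∑ i, hH.eigenvalues i) := by
    rw [schattenNorm, Real.sqrt_eq_rpow]
    congr 1
    refine Finset.sum_congr rfl fun i _ => ?_
    rw [Real.rpow_two,
      Real.sq_sqrt ((Matrix.posSemidef_conjTranspose_mul_self A).eigenvalues_nonneg i)]
  have h2 : ((∑ i, hH.eigenvalues i : ℝ) : ℂ) = ((∑ i, ∑ j, ‖A i j‖ ^ 2 : ℝ) : ℂ) := by
    have := hH.trace_eq_sum_eigenvalues
    push_cast
    rw [← RCLike.ofReal_eq_complex_ofReal, ← this, Matrix.trace, Finset.sum_comm]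
    refine Finset.sum_congr rfl fun j _ => ?_
    rw [Matrix.diag_apply, Matrix.mul_apply]
    refine Finset.sum_congr rfl fun i _ => ?_
    rw [Matrix.conjTranspose_apply, RCLike.star_def, RCLike.conj_mul]
  rw [h1, Real.sq_sqrt]
  · exact Complex.ofReal_injective h2
  · exact Finset.sum_nonneg fun i _ =>
      (Matrix.posSemidef_conjTranspose_mul_self A).eigenvalues_nonneg i

section Purification

variable {k n : ℕ} [NeZero k] [NeZero n]

/-- The state prepared by an oracle. -/
def preparedState (U : Matrix.unitaryGroup (Fin k × Fin n) ℂ) : Fin k × Fin n → ℂ :=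
  U.1 *ᵥ Pi.single ((0, 0) : Fin k × Fin n) 1

theorem preparedState_apply (U : Matrix.unitaryGroup (Fin k × Fin n) ℂ) (x : Fin k × Fin n) :
    preparedState U x = U.1 x (0, 0) := by
  simp [preparedState]

theorem sum_star_mul_preparedState (U : Matrix.unitaryGroup (Fin k × Fin n) ℂ) :
    ∑ x, star (preparedState U x) * preparedState U x = 1 := by
  have hU : U.1ᴴ * U.1 = 1 := Unitary.star_mul_self_of_mem U.2
  have h := congrFun (congrFun hU (0, 0)) (0, 0)
  rw [Matrix.mul_apply, Matrix.one_apply_eq] at h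
  simpa [preparedState_apply] using h

theorem IsPurifiedOracle.sum_preparedState {U : Matrix.unitaryGroup (Fin k × Fin n) ℂ}
    {ρ : Matrix (Fin n) (Fin n) ℂ} (h : IsPurifiedOracle U ρ) (b b' : Fin n) :
    ∑ a, star (preparedState U (a, b')) * preparedState U (a, b) = ρ b b' := by
  rw [← h]
  simp only [partialTraceA, Matrix.of_apply, Matrix.vecMulVec_apply, Pi.star_apply]
  exact Finset.sum_congr rfl fun a _ => mul_comm _ _

theorem mulVec_single_mul (U : Matrix.unitaryGroup (Fin k × Fin n) ℂ) (r : ℂ) (x : Fin k × Fin n) :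
    (U.1 *ᵥ fun x' => (Pi.single (0, 0) 1 : Fin k × Fin n → ℂ) x' * r) x
      = preparedState U x * r := by
  have : (fun x' => (Pi.single (0, 0) 1 : Fin k × Fin n → ℂ) x' * r)
      = r • (Pi.single (0, 0) 1 : Fin k × Fin n → ℂ) := by
    ext x'; simp [mul_comm]
  rw [this, Matrix.mulVec_smul, Pi.smul_apply, smul_eq_mul, mul_comm]
  rfl

theorem conjTranspose_mulVec_zero (U : Matrix.unitaryGroup (Fin k × Fin n) ℂ)
    (v : Fin k × Fin n → ℂ) :
    (U.1ᴴ *ᵥ v) (0, 0) = ∑ x, star (preparedState U x) * v x := by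
  simp [Matrix.mulVec, dotProduct, preparedState_apply]

end Purification

section Prepare

variable {k l n : ℕ} [NeZero k] [NeZero l] [NeZero n] {W : Type} [Fintype W]

/-- The state with both query registers in the zero state and the work space in the state `r`. -/
def zeroRegisters (k l n : ℕ) [NeZero k] [NeZero l] [NeZero n] (r : W → ℂ) : Memory k l n W → ℂ :=
  fun p => (Pi.single (0, 0) 1 : Fin k × Fin n → ℂ) p.1 *
    ((Pi.single (0, 0) 1 : Fin l × Fin n → ℂ) p.2.1 * r p.2.2)

theorem l2_zeroRegisters (r : W → ℂ) : l2 (zeroRegisters k l n r) = l2 r := by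
  rw [← pow_left_inj₀ (l2_nonneg _) (l2_nonneg _) two_ne_zero, l2_sq, l2_sq,
    Fintype.sum_prod_type, Finset.sum_eq_single (0, 0), Fintype.sum_prod_type,
    Finset.sum_eq_single (0, 0)]
  · simp [zeroRegisters]
  · intro y _ hy
    simp [zeroRegisters, Pi.single_eq_of_ne hy]
  · simp
  · intro x _ hx
    simp [zeroRegisters, Pi.single_eq_of_ne hx]
  · simp

theorem prepare_zeroRegisters [DecidableEq W] (Uρ : Matrix.unitaryGroup (Fin k × Fin n) ℂ)
    (Uσ : Matrix.unitaryGroup (Fin l × Fin n) ℂ) (r : W → ℂ) :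
    circuitMatrix Uρ Uσ [.query .rho, .query .sigma] *ᵥ zeroRegisters k l n r
      = fun p => preparedState Uρ p.1 * (preparedState Uσ p.2.1 * r p.2.2) := by
  ext ⟨x, y, w⟩
  simp only [circuitMatrix, Matrix.one_mul, QueryStep.toMatrix, ← Matrix.mulVec_mulVec,
    QueryStep.query_sigma_mulVec, QueryStep.query_rho_mulVec]
  simp only [zeroRegisters]
  simp only [mulVec_single_mul]
  have := mulVec_single_mul Uσ (preparedState Uρ x * r w) y
  rw [← mul_assoc, mul_comm (preparedState Uρ x), mul_assoc, ← this]
  congr 2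
  ext y'
  ring

end Prepare

/-- The gate that permutes the computational basis. -/
def permutationGate {ι : Type*} [Fintype ι] [DecidableEq ι] (e : Equiv.Perm ι) :
    Matrix.unitaryGroup ι ℂ :=
  ⟨e.permMatrix ℂ, Matrix.mem_unitaryGroup_iff.2 (by
    rw [Matrix.star_eq_conjTranspose, Matrix.conjTranspose_permMatrix, ← Matrix.permMatrix_mul]
    simp)⟩

theorem permutationGate_mulVec {ι : Type*} [Fintype ι] [DecidableEq ι] (e : Equiv.Perm ι)
    (v : ι → ℂ) (i : ι) : ((permutationGate e).1 *ᵥ v) i = v (e i) := by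
  rw [permutationGate, Matrix.permMatrix_mulVec, Function.comp_apply]

/-! ### Block encoding on a maximally entangled state -/

section BlockEncoding

variable {k l n : ℕ}

/-- The coin-controlled swap of the second part of a query register with the first part of the
work space. -/
def coinSwap (k l n : ℕ) : Memory k l n (Fin n × Fin n × Bool) →
    Memory k l n (Fin n × Fin n × Bool)
  | ((a, b), (a', b'), (x, y, false)) => ((a, x), (a', b'), (b, y, false))
  | ((a, b), (a', b'), (x, y, true)) => ((a, b), (a', x), (b', y, true))

theorem coinSwap_involutive (k l n : ℕ) : Function.Involutive (coinSwap k l n) := by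
  rintro ⟨⟨a, b⟩, ⟨a', b'⟩, x, y, _ | _⟩ <;> rfl

variable [NeZero k] [NeZero l] [NeZero n]

/-- The initial state of the work space: a maximally entangled state and a fair coin. -/
def entangledCoin (n : ℕ) : Fin n × Fin n × Bool → ℂ :=
  fun w => if w.1 = w.2.1 then ((1 / √(2 * n) : ℝ) : ℂ) else 0

theorem l2_entangledCoin : l2 (entangledCoin n) = 1 := by
  have hn : (0 : ℝ) < n := by exact_mod_cast Nat.pos_of_neZero n
  rw [← pow_left_inj₀ (l2_nonneg _) zero_le_one two_ne_zero, l2_sq, Fintype.sum_prod_type]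
  simp only [Fintype.sum_prod_type, entangledCoin, apply_ite norm, ite_pow, Complex.norm_real,
    Real.norm_eq_abs, sq_abs, div_pow, Real.sq_sqrt (by positivity : (0 : ℝ) ≤ 2 * n)]
  simp
  field_simp

/-- The circuit that block-encodes `ρ` or `σ`, depending on the coin. -/
def blockEncoding (k l n : ℕ) : List (QueryStep k l n (Fin n × Fin n × Bool)) :=
  [.query .rho, .query .sigma, .gate (permutationGate (coinSwap_involutive k l n).toPerm)] ++
    [.query .sigmaInv, .query .rhoInv]

/-- Both oracles are always run and undone. The register not chosen by the coin returns to zero with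
amplitude `1`. For the chosen one, the overlap of the swapped state with the prepared state
contracts the purifying index and leaves a matrix entry. -/
theorem blockEncoding_mulVec {Uρ : Matrix.unitaryGroup (Fin k × Fin n) ℂ}
    {Uσ : Matrix.unitaryGroup (Fin l × Fin n) ℂ} {ρ σ : Matrix (Fin n) (Fin n) ℂ}
    (hρ : IsPurifiedOracle Uρ ρ) (hσ : IsPurifiedOracle Uσ σ) (x y : Fin n) (c : Bool) :
    (circuitMatrix Uρ Uσ (blockEncoding k l n) *ᵥ zeroRegisters k l n (entangledCoin n))
        ((0, 0), ((0, 0), (x, y, c)))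
      = ((1 / √(2 * n) : ℝ) : ℂ) * (if c then σ x y else ρ x y) := by
  have h1 : circuitMatrix Uρ Uσ (blockEncoding k l n)
      = circuitMatrix Uρ Uσ [.query .sigmaInv, .query .rhoInv] *
        (circuitMatrix Uρ Uσ [.gate (permutationGate (coinSwap_involutive k l n).toPerm)] *
          circuitMatrix Uρ Uσ [.query .rho, .query .sigma]) := by
    rw [← circuitMatrix_append, ← circuitMatrix_append]; rfl
  rw [h1, ← Matrix.mulVec_mulVec, ← Matrix.mulVec_mulVec, prepare_zeroRegisters]
  simp only [circuitMatrix, Matrix.one_mul, QueryStep.toMatrix, ← Matrix.mulVec_mulVec,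
    QueryStep.query_rho_mulVec, QueryStep.query_sigma_mulVec, permutationGate_mulVec,
    conjTranspose_mulVec_zero, Function.Involutive.coe_toPerm]
  have hρ1 := sum_star_mul_preparedState Uρ
  have hσ1 := sum_star_mul_preparedState Uσ
  cases c
  · have : ∀ (p : Fin k × Fin n), (∑ q : Fin l × Fin n, star (preparedState Uσ q) *
        (preparedState Uρ (coinSwap k l n (p, (q, (x, y, false)))).1 *
          (preparedState Uσ (coinSwap k l n (p, (q, (x, y, false)))).2.1 *
            entangledCoin n (coinSwap k l n (p, (q, (x, y, false)))).2.2)))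
        = preparedState Uρ (p.1, x) * (if p.2 = y then ((1 / √(2 * n) : ℝ) : ℂ) else 0) := by
      rintro ⟨a, b⟩
      calc _ = ∑ q : Fin l × Fin n, (star (preparedState Uσ q) * preparedState Uσ q) *
            (preparedState Uρ (a, x) * (if b = y then ((1 / √(2 * n) : ℝ) : ℂ) else 0)) := by
              refine Finset.sum_congr rfl fun q _ => ?_
              simp only [coinSwap, entangledCoin]
              ring_nf
        _ = _ := by rw [← Finset.sum_mul, hσ1, one_mul]
    simp only [this, Fintype.sum_prod_type, mul_ite, mul_zero, Finset.sum_ite_eq',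
      Finset.mem_univ, if_true]
    simp only [← mul_assoc, ← Finset.sum_mul, hρ.sum_preparedState]
    rw [mul_comm]
    rfl
  · have : ∀ (p : Fin k × Fin n), (∑ q : Fin l × Fin n, star (preparedState Uσ q) *
        (preparedState Uρ (coinSwap k l n (p, (q, (x, y, true)))).1 *
          (preparedState Uσ (coinSwap k l n (p, (q, (x, y, true)))).2.1 *
            entangledCoin n (coinSwap k l n (p, (q, (x, y, true)))).2.2)))
        = preparedState Uρ p * (((1 / √(2 * n) : ℝ) : ℂ) * σ x y) := by
      rintro ⟨a, b⟩
      rw [← hσ.sum_preparedState, Fintype.sum_prod_type, Finset.mul_sum, Finset.mul_sum]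
      refine Finset.sum_congr rfl fun a' _ => ?_
      rw [Finset.sum_eq_single y _ (by simp)]
      · simp only [coinSwap, entangledCoin, if_true]
        ring
      · intro b' _ hb'
        simp [coinSwap, entangledCoin, hb']
    simp only [this]
    simp only [← mul_assoc]
    simp only [← Finset.sum_mul, hρ1, one_mul, if_true]

/-- The projection onto the coin state orthogonal to the fair coin. -/
def unfairCoin : Matrix Bool Bool ℂ := Matrix.of fun c c' => if c = c' then 1 / 2 else -1 / 2

/-- The projection onto zero query registers and the coin state orthogonal to the fair coin. -/
def differenceProjection (k l n : ℕ) [NeZero k] [NeZero l] [NeZero n] :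
    Matrix (Memory k l n (Fin n × Fin n × Bool)) (Memory k l n (Fin n × Fin n × Bool)) ℂ :=
  Matrix.single ((0, 0) : Fin k × Fin n) (0, 0) (1 : ℂ) ⊗ₖ
    (Matrix.single ((0, 0) : Fin l × Fin n) (0, 0) (1 : ℂ) ⊗ₖ
      ((1 : Matrix (Fin n) (Fin n) ℂ) ⊗ₖ ((1 : Matrix (Fin n) (Fin n) ℂ) ⊗ₖ unfairCoin)))

theorem differenceProjection_conjTranspose :
    (differenceProjection k l n)ᴴ = differenceProjection k l n := by
  have : unfairCoinᴴ = unfairCoin := by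
    ext c c'
    cases c <;> cases c' <;> simp [unfairCoin, Matrix.conjTranspose_apply]
  simp [differenceProjection, Matrix.conjTranspose_kronecker, Matrix.conjTranspose_single, this]

theorem differenceProjection_mul_self :
    differenceProjection k l n * differenceProjection k l n = differenceProjection k l n := by
  have : unfairCoin * unfairCoin = unfairCoin := by
    ext c c'
    cases c <;> cases c' <;> simp [unfairCoin, Matrix.mul_apply] <;> norm_num
  simp [differenceProjection, ← Matrix.mul_kronecker_mul, this]

theorem differenceProjection_mulVec (v : Memory k l n (Fin n × Fin n × Bool) → ℂ)
    (p : Fin k × Fin n) (q : Fin l × Fin n) (x y : Fin n) (c : Bool) :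
    (differenceProjection k l n *ᵥ v) (p, (q, (x, y, c)))
      = if p = (0, 0) ∧ q = (0, 0) then
          1 / 2 * (v ((0, 0), ((0, 0), (x, y, c))) - v ((0, 0), ((0, 0), (x, y, !c)))) else 0 := by
  simp only [differenceProjection, Matrix.mulVec, dotProduct,
    Fintype.sum_prod_type (α₁ := Fin k × Fin n), Fintype.sum_prod_type (α₁ := Fin l × Fin n),
    Matrix.kroneckerMap_apply, Fintype.sum_prod_type (α₁ := Fin n) (α₂ := Fin n × Bool),
    Fintype.sum_prod_type (α₁ := Fin n) (α₂ := Bool), Matrix.one_apply, Matrix.single_apply]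
  by_cases hp : p = (0, 0)
  · by_cases hq : q = (0, 0)
    · rw [Finset.sum_eq_single (0, 0) _ (by simp)]
      · rw [Finset.sum_eq_single (0, 0) _ (by simp)]
        · cases c <;> simp [hp, hq, unfairCoin, Finset.sum_add_distrib] <;> ring
        · intro q' _ hq'
          simp [hq'.symm]
      · intro p' _ hp'
        simp [hp'.symm]
    · have hq' : ¬ (0, 0) = q := fun h => hq h.symm
      simp [hq, hq']
  · have hp' : ¬ (0, 0) = p := fun h => hp h.symm
    simp [hp, hp']

/-- The unfair coin projection takes half the difference of the two branches. Each coin value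
contributes `|ρ x y - σ x y|² / (8n)`, and the two together give `1/(4n)`. -/
theorem l2_sq_differenceProjection_blockEncoding {Uρ : Matrix.unitaryGroup (Fin k × Fin n) ℂ}
    {Uσ : Matrix.unitaryGroup (Fin l × Fin n) ℂ} {ρ σ : Matrix (Fin n) (Fin n) ℂ}
    (hρ : IsPurifiedOracle Uρ ρ) (hσ : IsPurifiedOracle Uσ σ) :
    l2 (differenceProjection k l n *ᵥ (circuitMatrix Uρ Uσ (blockEncoding k l n) *ᵥ
      zeroRegisters k l n (entangledCoin n))) = schattenNorm 2 (ρ - σ) / (2 * √n) := by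
  have hn : (0 : ℝ) < n := by exact_mod_cast Nat.pos_of_neZero n
  rw [← pow_left_inj₀ (l2_nonneg _) (div_nonneg (schattenNorm_two_nonneg _) (by positivity))
    two_ne_zero, l2_sq, div_pow, mul_pow, Real.sq_sqrt hn.le, schattenNorm_two_sq,
    Fintype.sum_prod_type, Finset.sum_eq_single (0, 0) _ (by simp), Fintype.sum_prod_type,
    Finset.sum_eq_single (0, 0) _ (by simp), Fintype.sum_prod_type, Finset.sum_div]
  · refine Finset.sum_congr rfl fun x _ => ?_
    rw [Fintype.sum_prod_type, Finset.sum_div]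
    refine Finset.sum_congr rfl fun y _ => ?_
    have h1 : ∀ u v : ℂ, ‖(1 / 2 : ℂ) * (((1 / √(2 * n) : ℝ) : ℂ) * u
        - ((1 / √(2 * n) : ℝ) : ℂ) * v)‖ ^ 2 = ‖u - v‖ ^ 2 / (8 * n) := by
      intro u v
      rw [← mul_sub, norm_mul, norm_mul, mul_pow, mul_pow, Complex.norm_real, Real.norm_eq_abs,
        sq_abs, div_pow, Real.sq_sqrt (by positivity)]
      norm_num
      field_simp
      ring
    simp only [differenceProjection_mulVec, blockEncoding_mulVec hρ hσ, and_self, if_true,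
      Fintype.sum_bool, Bool.not_true, Bool.not_false, Bool.false_eq_true, if_false, h1]
    rw [norm_sub_rev (σ x y), Matrix.sub_apply]
    ring
  · rintro q - hq
    refine Finset.sum_eq_zero fun w _ => ?_
    obtain ⟨x, y, c⟩ := w
    simp [differenceProjection_mulVec, hq]
  · rintro p - hp
    refine Finset.sum_eq_zero fun w _ => ?_
    obtain ⟨q, x, y, c⟩ := w
    simp [differenceProjection_mulVec, hp]

end BlockEncoding

/-! ### Projections from signed involutions and the swap test -/

section SignedPermutation

variable {ι : Type*} [DecidableEq ι]

/-- The projection onto the `1`-eigenspace of the signed permutation of the computational basis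
given by an involution `e` and a sign `s`. -/
def signedPermutationProjection (e : ι → ι) (s : ι → ℂ) : Matrix ι ι ℂ :=
  (1 / 2 : ℂ) • (1 + Matrix.of fun p q => if e p = q then s p else 0)

variable {e : ι → ι} {s : ι → ℂ}

theorem signedPermutationProjection_conjTranspose (he : Function.Involutive e)
    (hs : ∀ p, star (s p) = s p) (hse : ∀ p, s (e p) = s p) :
    (signedPermutationProjection e s)ᴴ = signedPermutationProjection e s := by
  have : (Matrix.of fun p q => if e p = q then s p else 0)ᴴ
      = Matrix.of fun p q => if e p = q then s p else 0 := by
    ext p q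
    rw [Matrix.conjTranspose_apply, Matrix.of_apply, Matrix.of_apply]
    by_cases h : e p = q
    · rw [if_pos h, if_pos (by rw [← h, he]), hs, ← h, hse]
    · rw [if_neg h, if_neg fun h' => h (by rw [← h', he]), star_zero]
  rw [signedPermutationProjection, Matrix.conjTranspose_smul, Matrix.conjTranspose_add, this]
  simp

variable [Fintype ι]

theorem signedPermutationProjection_mul_self (he : Function.Involutive e)
    (hs : ∀ p, s p * s p = 1) (hse : ∀ p, s (e p) = s p) :
    signedPermutationProjection e s * signedPermutationProjection e s
      = signedPermutationProjection e s := by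
  have : (Matrix.of fun p q => if e p = q then s p else 0) *
      (Matrix.of fun p q => if e p = q then s p else 0) = 1 := by
    ext p q
    rw [Matrix.mul_apply, Finset.sum_eq_single (e p) _ (by simp)]
    · simp [he p, Matrix.one_apply, hse, hs]
    · intro j _ hj
      simp [hj.symm]
  simp only [signedPermutationProjection, Matrix.smul_mul, Matrix.mul_smul, mul_add, add_mul, this,
    mul_one, one_mul]
  module

/-- For a projection, `‖P ψ‖² = ⟨ψ, P ψ⟩`, so the length reads off the expectation of the signed
permutation. -/
theorem l2_sq_signedPermutationProjection_mulVec (he : Function.Involutive e)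
    (hs : ∀ p, star (s p) = s p) (hss : ∀ p, s p * s p = 1) (hse : ∀ p, s (e p) = s p)
    {ψ : ι → ℂ} (hψ : l2 ψ = 1) :
    ((l2 (signedPermutationProjection e s *ᵥ ψ) ^ 2 : ℝ) : ℂ)
      = 1 / 2 * (1 + ∑ p, star (ψ p) * (s p * ψ (e p))) := by
  rw [l2_sq_eq_dotProduct, star_mulVec_dotProduct_mulVec,
    signedPermutationProjection_conjTranspose he hs hse,
    signedPermutationProjection_mul_self he hss hse, signedPermutationProjection,
    Matrix.smul_mulVec, Matrix.add_mulVec, Matrix.one_mulVec, dotProduct_smul, dotProduct_add,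
    star_dotProduct_self_eq_one hψ, smul_eq_mul]
  congr 2
  simp [dotProduct, Matrix.mulVec]

end SignedPermutation

/-- The expectation of the swap of the second factors of two bipartite states. -/
theorem sum_swap_overlap {α β γ : Type*} [Fintype α] [Fintype β] [Fintype γ] (f : α × γ → ℂ)
    (g : β × γ → ℂ) :
    ∑ x, ∑ x', star (f x) * star (g x') * (f (x.1, x'.2) * g (x'.1, x.2))
      = ∑ b, ∑ b', (∑ a, star (f (a, b)) * f (a, b')) * ∑ a, star (g (a, b')) * g (a, b) := by
  simp only [Finset.sum_mul_sum, Fintype.sum_prod_type_right]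
  refine Finset.sum_congr rfl fun b _ => ?_
  rw [Finset.sum_comm]
  refine Finset.sum_congr rfl fun b' _ => Finset.sum_congr rfl fun a _ =>
    Finset.sum_congr rfl fun a' _ => ?_
  ring

section SwapTest

variable {k l n : ℕ}

/-- The work space of the swap test: a second copy of both query registers and two coins. -/
abbrev SwapTestSpace (k l n : ℕ) : Type :=
  ((Fin k × Fin n) × (Fin l × Fin n)) × (Bool × Bool)

instance (k l n : ℕ) : DecidableEq (SwapTestSpace k l n) :=
  instDecidableEqProd

/-- Exchanging the query registers with their copies in the work space. -/
def exchangeCopies (k l n : ℕ) (p : Memory k l n (SwapTestSpace k l n)) :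
    Memory k l n (SwapTestSpace k l n) :=
  (p.2.2.1.1, (p.2.2.1.2, ((p.1, p.2.1), p.2.2.2)))

theorem exchangeCopies_involutive (k l n : ℕ) : Function.Involutive (exchangeCopies k l n) :=
  fun _ => rfl

/-- The swap of the system part of a first register, chosen by the first coin, with the system part
of a second register, chosen by the second coin. -/
def coinSwapTest (k l n : ℕ) : Memory k l n (SwapTestSpace k l n) →
    Memory k l n (SwapTestSpace k l n)
  | (x, y, (x', y'), (false, false)) => ((x.1, x'.2), y, ((x'.1, x.2), y'), (false, false))
  | (x, y, (x', y'), (false, true)) => ((x.1, y'.2), y, (x', (y'.1, x.2)), (false, true))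
  | (x, y, (x', y'), (true, false)) => (x, (y.1, x'.2), ((x'.1, y.2), y'), (true, false))
  | (x, y, (x', y'), (true, true)) => (x, (y.1, y'.2), (x', (y'.1, y.2)), (true, true))

theorem coinSwapTest_involutive (k l n : ℕ) : Function.Involutive (coinSwapTest k l n) := by
  rintro ⟨x, y, ⟨x', y'⟩, _ | _, _ | _⟩ <;> rfl

/-- The product of the signs of the two coins. -/
def coinSign (p : Memory k l n (SwapTestSpace k l n)) : ℂ :=
  if p.2.2.2.1 = p.2.2.2.2 then 1 else -1

theorem star_coinSign (p : Memory k l n (SwapTestSpace k l n)) :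
    star (coinSign p) = coinSign p := by
  rw [coinSign]; split_ifs <;> simp

theorem coinSign_mul_self (p : Memory k l n (SwapTestSpace k l n)) :
    coinSign p * coinSign p = 1 := by
  rw [coinSign]; split_ifs <;> simp

theorem coinSign_coinSwapTest (p : Memory k l n (SwapTestSpace k l n)) :
    coinSign (coinSwapTest k l n p) = coinSign p := by
  obtain ⟨x, y, ⟨x', y'⟩, _ | _, _ | _⟩ := p <;> rfl

variable [NeZero k] [NeZero l] [NeZero n]

/-- The initial state of the work space: zero registers and two fair coins. -/
def fairCoins (k l n : ℕ) [NeZero k] [NeZero l] [NeZero n] : SwapTestSpace k l n → ℂ :=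
  fun w => (Pi.single (0, 0) 1 : Fin k × Fin n → ℂ) w.1.1 *
    ((Pi.single (0, 0) 1 : Fin l × Fin n → ℂ) w.1.2 * (1 / 2))

theorem l2_fairCoins : l2 (fairCoins k l n) = 1 := by
  rw [← pow_left_inj₀ (l2_nonneg _) zero_le_one two_ne_zero, l2_sq, Fintype.sum_prod_type,
    Finset.sum_eq_single ((0, 0), (0, 0)) _ (by simp)]
  · simp [fairCoins]
    norm_num
  · rintro ⟨x, y⟩ - h
    by_cases hx : x = (0, 0)
    · have hy : y ≠ (0, 0) := fun hy => h (by rw [hx, hy])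
      simp [fairCoins, Pi.single_eq_of_ne hy]
    · simp [fairCoins, Pi.single_eq_of_ne hx]

/-- The circuit that prepares two copies of the states of both oracles. -/
def prepareCopies (k l n : ℕ) : List (QueryStep k l n (SwapTestSpace k l n)) :=
  [.query .rho, .query .sigma] ++
    ([.gate (permutationGate (exchangeCopies_involutive k l n).toPerm)] ++
      [.query .rho, .query .sigma])

/-- Exchanging the registers stores the first copies in the work space and brings fresh zero
registers back for a second preparation. -/
theorem prepareCopies_mulVec (Uρ : Matrix.unitaryGroup (Fin k × Fin n) ℂ)
    (Uσ : Matrix.unitaryGroup (Fin l × Fin n) ℂ) :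
    circuitMatrix Uρ Uσ (prepareCopies k l n) *ᵥ zeroRegisters k l n (fairCoins k l n)
      = fun p => preparedState Uρ p.1 * (preparedState Uσ p.2.1 *
          (preparedState Uρ p.2.2.1.1 * (preparedState Uσ p.2.2.1.2 * (1 / 2)))) := by
  rw [prepareCopies, circuitMatrix_append, circuitMatrix_append, ← Matrix.mulVec_mulVec,
    ← Matrix.mulVec_mulVec, prepare_zeroRegisters,
    ← prepare_zeroRegisters Uρ Uσ (fun w : SwapTestSpace k l n => preparedState Uρ w.1.1 *
      (preparedState Uσ w.1.2 * (1 / 2)))]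
  congr 1
  ext p
  simp only [circuitMatrix_singleton, QueryStep.toMatrix, permutationGate_mulVec,
    Function.Involutive.coe_toPerm, exchangeCopies, zeroRegisters, fairCoins]
  ring

/-- Each coin pair has weight `1/4` and swaps one chosen state of each copy; the two idle registers
contribute norm `1`. The swap expectations are traces of products, and the signs assemble them into
`Tr ρρ - Tr ρσ - Tr σρ + Tr σσ`. -/
theorem sum_star_mul_coinSwapTest {Uρ : Matrix.unitaryGroup (Fin k × Fin n) ℂ}
    {Uσ : Matrix.unitaryGroup (Fin l × Fin n) ℂ} {ρ σ : Matrix (Fin n) (Fin n) ℂ}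
    (hρ : IsPurifiedOracle Uρ ρ) (hσ : IsPurifiedOracle Uσ σ)
    {ψ : Memory k l n (SwapTestSpace k l n) → ℂ}
    (hψ : ψ = fun p => preparedState Uρ p.1 * (preparedState Uσ p.2.1 *
          (preparedState Uρ p.2.2.1.1 * (preparedState Uσ p.2.2.1.2 * (1 / 2))))) :
    ∑ p, star (ψ p) * (coinSign p * ψ (coinSwapTest k l n p))
      = 1 / 4 * ∑ b, ∑ b', (ρ - σ) b' b * (ρ - σ) b b' := by
  set f := preparedState Uρ
  set g := preparedState Uσ
  have hf1 : ∑ x, star (f x) * f x = 1 := sum_star_mul_preparedState Uρ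
  have hg1 : ∑ y, star (g y) * g y = 1 := sum_star_mul_preparedState Uσ
  have hcoins : ∀ x y x' y', ∑ c, star (ψ (x, (y, ((x', y'), c)))) *
      (coinSign ((x, (y, ((x', y'), c))) : Memory k l n (SwapTestSpace k l n)) *
        ψ (coinSwapTest k l n (x, (y, ((x', y'), c)))))
      = 1 / 4 * ((star (f x) * star (f x') * (f (x.1, x'.2) * f (x'.1, x.2))) *
            ((star (g y) * g y) * (star (g y') * g y'))
          - (star (f x) * star (g y') * (f (x.1, y'.2) * g (y'.1, x.2))) *
            ((star (g y) * g y) * (star (f x') * f x'))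
          - (star (g y) * star (f x') * (g (y.1, x'.2) * f (x'.1, y.2))) *
            ((star (f x) * f x) * (star (g y') * g y'))
          + (star (g y) * star (g y') * (g (y.1, y'.2) * g (y'.1, y.2))) *
            ((star (f x) * f x) * (star (f x') * f x'))) := by
    intro x y x' y'
    have h2 : star (1 / 2 : ℂ) = 1 / 2 := by simp
    simp only [Fintype.sum_prod_type, Fintype.sum_bool, hψ, coinSwapTest, coinSign, star_mul', h2,
      if_true, Bool.true_eq_false, Bool.false_eq_true, if_false]
    ring
  rw [Fintype.sum_prod_type]
  simp only [Fintype.sum_prod_type (α₁ := Fin l × Fin n) (α₂ := SwapTestSpace k l n),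
    Fintype.sum_prod_type (α₁ := (Fin k × Fin n) × (Fin l × Fin n)) (α₂ := Bool × Bool),
    Fintype.sum_prod_type (α₁ := Fin k × Fin n) (α₂ := Fin l × Fin n)]
  simp only [hcoins]
  simp only [← Finset.mul_sum, Finset.sum_add_distrib, Finset.sum_sub_distrib]
  simp only [← Finset.mul_sum, ← Finset.sum_mul, hf1, hg1, mul_one]
  rw [sum_swap_overlap f f, sum_swap_overlap f g, sum_swap_overlap g f, sum_swap_overlap g g]
  have hf : ∀ b b', ∑ a, star (f (a, b')) * f (a, b) = ρ b b' := hρ.sum_preparedState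
  have hg : ∀ b b', ∑ a, star (g (a, b')) * g (a, b) = σ b b' := hσ.sum_preparedState
  simp only [hf, hg, ← Finset.sum_sub_distrib, ← Finset.sum_add_distrib, Matrix.sub_apply]
  congr 1
  refine Finset.sum_congr rfl fun b _ => Finset.sum_congr rfl fun b' _ => ?_
  ring

theorem l2_sq_swapTest {Uρ : Matrix.unitaryGroup (Fin k × Fin n) ℂ}
    {Uσ : Matrix.unitaryGroup (Fin l × Fin n) ℂ} {ρ σ : Matrix (Fin n) (Fin n) ℂ}
    (hρ : IsPurifiedOracle Uρ ρ) (hσ : IsPurifiedOracle Uσ σ) (hH : (ρ - σ).IsHermitian) :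
    l2 (signedPermutationProjection (coinSwapTest k l n) coinSign *ᵥ
      (circuitMatrix Uρ Uσ (prepareCopies k l n) *ᵥ zeroRegisters k l n (fairCoins k l n))) ^ 2
      = 1 / 2 * (1 + 1 / 4 * schattenNorm 2 (ρ - σ) ^ 2) := by
  apply Complex.ofReal_injective
  rw [l2_sq_signedPermutationProjection_mulVec (coinSwapTest_involutive k l n) star_coinSign
    coinSign_mul_self coinSign_coinSwapTest, sum_star_mul_coinSwapTest hρ hσ
      (prepareCopies_mulVec Uρ Uσ), schattenNorm_two_sq]
  · push_cast
    congr 4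
    ext b
    refine Finset.sum_congr rfl fun b' _ => ?_
    -- Hermiticity turns `Tr (ρ - σ)²` into a sum of squared moduli.
    rw [← hH.apply b' b, RCLike.star_def, RCLike.conj_mul]
    rfl
  · rw [l2_mulVec_of_conjTranspose_mul_self (circuitMatrix_conjTranspose_mul_self _ _ _),
      l2_zeroRegisters, l2_fairCoins]

end SwapTest

/-! ### The two tests and their combination -/

/-- The test through a maximally entangled state. -/
theorem exists_algorithm_sqrt_dim (n k l : ℕ) [NeZero n] [NeZero k] [NeZero l] {ε ν : ℝ}
    (hε : 0 < ε) (hε1 : ε < 1) (hν : 0 < ν) (hν1 : ν < 1) :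
    ∃ 𝒜 : QueryAlgorithm k l n, (𝒜.queryCount : ℝ) ≤ 280 * (√n / ε * (1 / ν)) ∧
      ∀ (ρ σ : Matrix (Fin n) (Fin n) ℂ) (Uρ : Matrix.unitaryGroup (Fin k × Fin n) ℂ)
        (Uσ : Matrix.unitaryGroup (Fin l × Fin n) ℂ),
        IsPurifiedOracle Uρ ρ → IsPurifiedOracle Uσ σ →
          (ε ≤ schattenNorm 2 (ρ - σ) → 2 / 3 ≤ 𝒜.outputProb Uρ Uσ true) ∧
          (schattenNorm 2 (ρ - σ) ≤ (1 - ν) * ε → 2 / 3 ≤ 𝒜.outputProb Uρ Uσ false) := by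
  have hn : 1 ≤ √(n : ℝ) := Real.one_le_sqrt.2 (by exact_mod_cast Nat.pos_of_neZero n)
  have hδ1 : ν * ε / (2 * √n) ≤ 1 := by
    rw [div_le_one (by positivity)]
    nlinarith
  obtain ⟨𝒜, hcount, h⟩ := exists_algorithm_of_circuit (blockEncoding k l n)
    ((l2_zeroRegisters _).trans l2_entangledCoin) differenceProjection_conjTranspose
    differenceProjection_mul_self (α := ε / (2 * √n)) (δ := ν * ε / (2 * √n)) (by positivity) hδ1
  refine ⟨𝒜, hcount.trans (le_of_eq ?_), fun ρ σ Uρ Uσ hρ hσ => ?_⟩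
  · have : (blockEncoding k l n).countP QueryStep.isQuery = 4 := rfl
    rw [this]
    field_simp
    norm_num
  · have h1 := h Uρ Uσ
    rw [l2_sq_differenceProjection_blockEncoding hρ hσ, ← sub_div,
      div_le_div_iff_of_pos_right (by positivity), div_le_div_iff_of_pos_right (by positivity)] at h1
    exact ⟨h1.1, fun h2 => h1.2 (h2.trans (le_of_eq (by ring)))⟩

/-- The test through a swap test. -/
theorem exists_algorithm_swapTest (n k l : ℕ) [NeZero n] [NeZero k] [NeZero l] {ε ν : ℝ}
    (hε : 0 < ε) (hε1 : ε < 1) (hν : 0 < ν) (hν1 : ν < 1) :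
    ∃ 𝒜 : QueryAlgorithm k l n, (𝒜.queryCount : ℝ) ≤ 2240 * (1 / ε ^ 2 * (1 / ν)) ∧
      ∀ (ρ σ : Matrix (Fin n) (Fin n) ℂ) (Uρ : Matrix.unitaryGroup (Fin k × Fin n) ℂ)
        (Uσ : Matrix.unitaryGroup (Fin l × Fin n) ℂ), (ρ - σ).IsHermitian →
        IsPurifiedOracle Uρ ρ → IsPurifiedOracle Uσ σ →
          (ε ≤ schattenNorm 2 (ρ - σ) → 2 / 3 ≤ 𝒜.outputProb Uρ Uσ true) ∧
          (schattenNorm 2 (ρ - σ) ≤ (1 - ν) * ε → 2 / 3 ≤ 𝒜.outputProb Uρ Uσ false) := by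
  have hε2 : ε ^ 2 ≤ 1 := pow_le_one₀ hε.le hε1.le
  have hδ1 : ε ^ 2 * ν / 16 ≤ 1 := by nlinarith
  obtain ⟨𝒜, hcount, h⟩ := exists_algorithm_of_circuit (prepareCopies k l n)
    ((l2_zeroRegisters _).trans l2_fairCoins)
    (signedPermutationProjection_conjTranspose (coinSwapTest_involutive k l n) star_coinSign
      coinSign_coinSwapTest)
    (signedPermutationProjection_mul_self (coinSwapTest_involutive k l n) coinSign_mul_self
      coinSign_coinSwapTest) (α := √(1 / 2 * (1 + 1 / 4 * ε ^ 2))) (δ := ε ^ 2 * ν / 16)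
    (by positivity) hδ1
  refine ⟨𝒜, hcount.trans (le_of_eq ?_), fun ρ σ Uρ Uσ hH hρ hσ => ?_⟩
  · have : (prepareCopies k l n).countP QueryStep.isQuery = 4 := rfl
    rw [this]
    field_simp
    norm_num
  · obtain ⟨h1, h2⟩ := h Uρ Uσ
    have hsq := l2_sq_swapTest hρ hσ hH
    set a := l2 (signedPermutationProjection (coinSwapTest k l n) coinSign *ᵥ
      (circuitMatrix Uρ Uσ (prepareCopies k l n) *ᵥ zeroRegisters k l n (fairCoins k l n)))
    have ha : 0 ≤ a := l2_nonneg _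
    have hS := schattenNorm_two_nonneg (ρ - σ)
    refine ⟨fun hle => h1 ?_, fun hle => h2 ?_⟩
    · rw [Real.sqrt_le_left ha, hsq]
      gcongr
    · set α := √(1 / 2 * (1 + 1 / 4 * ε ^ 2)) with hα
      have hα0 : 0 ≤ α := Real.sqrt_nonneg _
      have hα2 : α ^ 2 = 1 / 2 * (1 + 1 / 4 * ε ^ 2) := Real.sq_sqrt (by positivity)
      have hα1 : α ≤ 1 := by nlinarith
      have hS2 : schattenNorm 2 (ρ - σ) ^ 2 ≤ ((1 - ν) * ε) ^ 2 := pow_le_pow_left₀ hS hle 2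
      -- This uses `1 - (1 - ν)² = ν(2 - ν) ≥ ν`.
      have hgap : ε ^ 2 * ν / 8 ≤ α ^ 2 - a ^ 2 := by
        have : 0 ≤ ε ^ 2 * (ν * (1 - ν)) := by
          have := sub_pos.2 hν1
          positivity
        nlinarith
      have haα : a ≤ α := by
        refine le_of_sq_le_sq ?_ hα0
        have : 0 ≤ ε ^ 2 * ν / 8 := by positivity
        linarith
      -- Since `α + a ≤ 2`, the gap between the squares yields half of it, `ε²ν/16`, between the
      -- amplitudes.
      nlinarith

end

theorem mainTheorem4 :
    ∃ C : ℝ, 0 < C ∧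
      ∀ (n k l : ℕ) [NeZero n] [NeZero k] [NeZero l] (ε ν : ℝ),
        0 < ε → ε < 1 → 0 < ν → ν < 1 →
        ∃ 𝒜 : QueryAlgorithm k l n,
          (𝒜.queryCount : ℝ) ≤ C * (min (Real.sqrt (n : ℝ) / ε) (1 / ε ^ 2) * (1 / ν)) ∧
          ∀ (ρ σ : Matrix (Fin n) (Fin n) ℂ)
            (Uρ : Matrix.unitaryGroup (Fin k × Fin n) ℂ)
            (Uσ : Matrix.unitaryGroup (Fin l × Fin n) ℂ),
            IsDensityOperator ρ → IsDensityOperator σ →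
            IsPurifiedOracle Uρ ρ → IsPurifiedOracle Uσ σ →
            (ε ≤ schattenNorm 2 (ρ - σ) → 2 / 3 ≤ 𝒜.outputProb Uρ Uσ true) ∧
            (schattenNorm 2 (ρ - σ) ≤ (1 - ν) * ε → 2 / 3 ≤ 𝒜.outputProb Uρ Uσ false) := by
  -- Each base circuit makes four queries: the swap test costs `35 * 4 * 16 = 2240`, the entangled
  -- test only `35 * 4 * 2 = 280`.
  refine ⟨2240, by norm_num, fun n k l _ _ _ ε ν hε hε1 hν hν1 => ?_⟩
  rcases le_total (√(n : ℝ) / ε) (1 / ε ^ 2) with hmin | hmin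
  · obtain ⟨𝒜, hcount, h⟩ := exists_algorithm_sqrt_dim n k l hε hε1 hν hν1
    refine ⟨𝒜, hcount.trans ?_, fun ρ σ Uρ Uσ _ _ => h ρ σ Uρ Uσ⟩
    rw [min_eq_left hmin]
    gcongr
    norm_num
  · obtain ⟨𝒜, hcount, h⟩ := exists_algorithm_swapTest n k l hε hε1 hν hν1
    refine ⟨𝒜, hcount.trans (le_of_eq ?_), fun ρ σ Uρ Uσ hρ hσ =>
      h ρ σ Uρ Uσ (hρ.1.isHermitian.sub hσ.1.isHermitian)⟩
    rw [min_eq_right hmin]
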